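/- Let $p$ be a prime number and let $(R,\mathfrak m)$ be a Cohen–Macaulay Noetherian local ring of characteristic $p$ and of Krull dimension $d>0$. For $n\ge 0$ let ${}^{f^n}\!R$ denote $R$ regarded as an $R$-module by restriction of scalars along the $n$-th iterate $f^n\colon r\mapsto r^{p^n}$ of the Frobenius endomorphism. Define \[ \kappa(R)=\inf\{t\ge 0 : \text{there is a system of parameters } \mathbf y \text{ of } R \text{ such that } \mathfrak m^{[p^t]}\subseteq(\mathbf y)\}, \] where $\mathfrak m^{[p^t]}$ is the ideal generated by the $p^t$-th powers of the elements of $\mathfrak m$. Let $M$ be a finitely generated Cohen–Macaulay $R$-module of codimension $1$, that is, $\dim R-\dim M=1$. Let $\mathbf x$ be any system of parameters for $M$ which is also an $R$-regular sequence. Then the following are equivalent: \begin{enumerate} \item $\operatorname{pd}_R M<\infty$; \item $\operatorname{Tor}_i^R(M/\mathbf xM,{}^{f^n}\!R)=0$ for all $i>0$ and all $n>0$; \item there exist an $i>0$ and an $n\ge\kappa(R)$ such that $\operatorname{Tor}_i^R(M/\mathbf xM,{}^{f^n}\!R)=0$. \end{enumerate} -/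

import Mathlib

universe u

open CategoryTheory IsLocalRing

noncomputable section

namespace FrobeniusRigidity

/-- The depth of a module over a local ring: the supremum of the lengths of the `M`-regular
sequences contained in the maximal ideal. -/
def depth (R : Type*) [CommRing R] [IsLocalRing R]
    (M : Type*) [AddCommGroup M] [Module R M] : ℕ∞ :=
  ⨆ rs ∈ {rs : List R | (∀ r ∈ rs, r ∈ maximalIdeal R) ∧ RingTheory.Sequence.IsRegular M rs},
    (rs.length : ℕ∞)

/-- A (finitely generated) module over a Noetherian local ring is Cohen–Macaulay if it is zero or
its depth equals its dimension. -/
def IsCohenMacaulayModule (R : Type*) [CommRing R] [IsLocalRing R]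
    (M : Type*) [AddCommGroup M] [Module R M] : Prop :=
  Subsingleton M ∨ (depth R M : WithBot ℕ∞) = Module.supportDim R M

/-- The quotient `M / xM` of a module by a finite sequence `x` of ring elements. -/
abbrev quotSeq {R : Type*} [CommRing R] (M : Type*) [AddCommGroup M] [Module R M]
    (xs : List R) : Type _ :=
  M ⧸ (Ideal.ofList xs • ⊤ : Submodule R M)

/-- `xs` is a system of parameters for `M`: it consists of `dim M` elements of the maximal ideal,
and `M / xs M` has finite length. -/
structure IsSystemOfParameters {R : Type*} [CommRing R] [IsLocalRing R]
    (M : Type*) [AddCommGroup M] [Module R M] (xs : List R) : Prop where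
  mem_maximalIdeal : ∀ x ∈ xs, x ∈ maximalIdeal R
  length_eq : ((xs.length : ℕ∞) : WithBot ℕ∞) = Module.supportDim R M
  finite_length : IsFiniteLength R (quotSeq M xs)

/-- `κ(R)`: the least `t` for which some system of parameters `x` of `R` satisfies
`𝔪^[p^t] ⊆ (x)`. The Frobenius power `𝔪^[p^t]` is the ideal generated by the image of `𝔪` under
the `t`-th iterate of the Frobenius. -/
def kappa (R : Type*) [CommRing R] [IsLocalRing R] (p : ℕ) [Fact p.Prime] [CharP R p] : ℕ :=
  sInf {t : ℕ | ∃ xs : List R, IsSystemOfParameters R xs ∧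
    (maximalIdeal R).map (iterateFrobenius R p t) ≤ Ideal.ofList xs}

/-- The ring `R` as an `R`-module through the `n`-th iterate of the Frobenius:
`r • s = r ^ (p ^ n) * s`. -/
def frobeniusModule (R : Type u) [CommRing R] (p : ℕ) [Fact p.Prime] [CharP R p] (n : ℕ) :
    ModuleCat.{u} R :=
  (ModuleCat.restrictScalars (iterateFrobenius R p n)).obj (ModuleCat.of R R)

/-- `Tor_i(N, ^{f^n}R)`: the value at `N` of the `i`-th left derived functor
of `- ⊗ ^{f^n}R`. -/
def frobeniusTor (R : Type u) [CommRing R] (p : ℕ) [Fact p.Prime] [CharP R p] (i n : ℕ)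
    (N : Type u) [AddCommGroup N] [Module R N] : ModuleCat.{u} R :=
  ((Tor' (ModuleCat.{u} R) i).obj (ModuleCat.of R N)).obj (frobeniusModule R p n)

end FrobeniusRigidity

end

namespace RingTheory.Sequence

open Function Submodule
open scoped Pointwise

variable {R : Type*} [CommRing R]
variable {A B C : Type*} [AddCommGroup A] [AddCommGroup B] [AddCommGroup C]
  [Module R A] [Module R B] [Module R C]

lemma mk_mem_ofList_smul_top_iff (r : R) (rs : List R) (a : A) :
    (Submodule.Quotient.mk a : QuotSMulTop r A) ∈ (Ideal.ofList rs • ⊤ : Submodule R _) ↔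
      a ∈ (Ideal.ofList (r :: rs) • ⊤ : Submodule R A) := by
  rw [Ideal.ofList_cons_smul, ← Submodule.mkQ_apply, ← Submodule.mem_comap,
    Submodule.comap_smul_top_of_surjective _ _ (Submodule.mkQ_surjective _), Submodule.ker_mkQ,
    sup_comm]

lemma quotSMulTop_map_injective {r : R} {f : A →ₗ[R] B} {g : B →ₗ[R] C} (hf : Injective f)
    (hfg : Exact f g) (hr : IsSMulRegular C r) : Injective (QuotSMulTop.map r f) := by
  rw [injective_iff_map_eq_zero]
  intro a ha
  obtain ⟨a, rfl⟩ := Submodule.mkQ_surjective _ a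
  rw [Submodule.mkQ_apply, QuotSMulTop.map_apply_mk, Submodule.Quotient.mk_eq_zero,
    Submodule.mem_smul_pointwise_iff_exists] at ha
  obtain ⟨b, -, hb⟩ := ha
  have hgb : g b = 0 := hr <| by
    simp only [smul_zero, ← map_smul, hb]
    exact (hfg _).2 ⟨a, rfl⟩
  obtain ⟨a', rfl⟩ := (hfg b).1 hgb
  rw [← map_smul] at hb
  rw [Submodule.mkQ_apply, Submodule.Quotient.mk_eq_zero, ← hf hb]
  exact Submodule.smul_mem_pointwise_smul _ _ _ trivial

/-- In a short exact sequence, reduction modulo a sequence that is weakly regular on the third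
term keeps the first map injective. -/
lemma mem_ofList_smul_top_of_exact {xs : List R} {f : A →ₗ[R] B} {g : B →ₗ[R] C}
    (hf : Injective f) (hfg : Exact f g) (hg : Surjective g) (hx : IsWeaklyRegular C xs)
    {a : A} (ha : f a ∈ (Ideal.ofList xs • ⊤ : Submodule R B)) :
    a ∈ (Ideal.ofList xs • ⊤ : Submodule R A) := by
  induction xs generalizing A B C with
  | nil => simpa [Ideal.ofList_nil, (injective_iff_map_eq_zero' f).1 hf] using ha
  | cons r rs ih =>
    rw [isWeaklyRegular_cons_iff] at hx
    rw [← mk_mem_ofList_smul_top_iff] at ha ⊢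
    exact ih (quotSMulTop_map_injective hf hfg hx.1) (QuotSMulTop.map_exact r hfg hg)
      (QuotSMulTop.map_surjective r hg) hx.2 (by rwa [QuotSMulTop.map_apply_mk])

lemma IsWeaklyRegular.of_exact_left {xs : List R} {f : A →ₗ[R] B} {g : B →ₗ[R] C}
    (hf : Injective f) (hfg : Exact f g) (hg : Surjective g) (hB : IsWeaklyRegular B xs)
    (hC : IsWeaklyRegular C xs) : IsWeaklyRegular A xs := by
  induction xs generalizing A B C with
  | nil => exact .nil R A
  | cons r rs ih =>
    rw [isWeaklyRegular_cons_iff] at hB hC ⊢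
    exact ⟨hB.1.of_injective f hf, ih (quotSMulTop_map_injective hf hfg hC.1)
      (QuotSMulTop.map_exact r hfg hg) (QuotSMulTop.map_surjective r hg) hB.2 hC.2⟩

lemma IsWeaklyRegular.of_exact_middle {xs : List R} {f : A →ₗ[R] B} {g : B →ₗ[R] C}
    (hf : Injective f) (hfg : Exact f g) (hg : Surjective g) (hA : IsWeaklyRegular A xs)
    (hC : IsWeaklyRegular C xs) : IsWeaklyRegular B xs := by
  induction xs generalizing A B C with
  | nil => exact .nil R B
  | cons r rs ih =>
    rw [isWeaklyRegular_cons_iff] at hA hC ⊢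
    exact ⟨isSMulRegular_of_range_eq_ker hf hfg.linearMap_ker_eq.symm hA.1 hC.1,
      ih (quotSMulTop_map_injective hf hfg hC.1)
      (QuotSMulTop.map_exact r hfg hg) (QuotSMulTop.map_surjective r hg) hA.2 hC.2⟩

/-- For an `A`-regular element `r`, the sequence `A / r ^ n → A / r ^ (n + 1) → A / r` is short
exact; hence sequences weakly regular on `A / r` are weakly regular on all `A / r ^ n`. -/
lemma IsWeaklyRegular.quotSMulTop_pow {r : R} {rs : List R} (hr : IsSMulRegular A r)
    (hrs : IsWeaklyRegular (QuotSMulTop r A) rs) (n : ℕ) :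
    IsWeaklyRegular (QuotSMulTop (r ^ n) A) rs := by
  induction n with
  | zero =>
    have : Subsingleton (QuotSMulTop (r ^ 0) A) := by
      rw [Submodule.Quotient.subsingleton_iff]; simp
    exact ⟨fun i h => fun a b _ => Subsingleton.elim _ _⟩
  | succ n ih =>
    have hle : (r ^ n • ⊤ : Submodule R A) ≤
        (r ^ (n + 1) • ⊤ : Submodule R A).comap (LinearMap.lsmul R A r) := by
      intro x hx
      obtain ⟨y, -, rfl⟩ := (Submodule.mem_smul_pointwise_iff_exists _ _ _).1 hx
      exact (Submodule.mem_smul_pointwise_iff_exists _ _ _).2 ⟨y, trivial, by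
        simp only [pow_succ', mul_smul, LinearMap.lsmul_apply]⟩
    have hle' : (r ^ (n + 1) • ⊤ : Submodule R A) ≤ (r • ⊤ : Submodule R A) := by
      intro x hx
      obtain ⟨y, -, rfl⟩ := (Submodule.mem_smul_pointwise_iff_exists _ _ _).1 hx
      exact (Submodule.mem_smul_pointwise_iff_exists _ _ _).2 ⟨r ^ n • y, trivial, by
        simp [pow_succ', mul_smul]⟩
    refine IsWeaklyRegular.of_exact_middle
      (f := (r ^ n • ⊤ : Submodule R A).mapQ (r ^ (n + 1) • ⊤) (LinearMap.lsmul R A r) hle)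
      (g := Submodule.factor hle') ?_ ?_ (Submodule.factor_surjective hle') ih hrs
    · rw [injective_iff_map_eq_zero]
      intro a ha
      obtain ⟨a, rfl⟩ := Submodule.mkQ_surjective _ a
      simp only [Submodule.mkQ_apply, Submodule.mapQ_apply, LinearMap.lsmul_apply,
        Submodule.Quotient.mk_eq_zero, Submodule.mem_smul_pointwise_iff_exists] at ha ⊢
      obtain ⟨b, -, hb⟩ := ha
      exact ⟨b, trivial, hr (by simpa [pow_succ', mul_smul] using hb)⟩
    · intro b
      obtain ⟨b, rfl⟩ := Submodule.mkQ_surjective _ b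
      have hb : Submodule.factor hle' (Submodule.mkQ _ b) = 0 ↔ ∃ c, r • c = b := by
        simp [Submodule.mem_smul_pointwise_iff_exists]
      rw [hb]
      constructor
      · rintro ⟨c, rfl⟩
        exact ⟨Submodule.Quotient.mk c, rfl⟩
      · rintro ⟨c, hc⟩
        obtain ⟨c, rfl⟩ := Submodule.mkQ_surjective _ c
        replace hc : r • c - b ∈ (r ^ (n + 1) • ⊤ : Submodule R A) := (Submodule.Quotient.eq _).1 hc
        obtain ⟨y, -, hy⟩ := (Submodule.mem_smul_pointwise_iff_exists _ _ _).1 hc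
        exact ⟨c - r ^ n • y, by
          rw [smul_sub, ← mul_smul, ← pow_succ', hy]; abel⟩

/-- Powers of the members of a weakly regular sequence form a weakly regular sequence. -/
lemma IsWeaklyRegular.map_pow {rs : List R} (h : IsWeaklyRegular A rs) (n : ℕ) :
    IsWeaklyRegular A (rs.map (· ^ n)) := by
  induction rs generalizing A with
  | nil => exact .nil R A
  | cons r rs ih =>
    rw [List.map_cons]
    rw [isWeaklyRegular_cons_iff] at h ⊢
    exact ⟨h.1.pow n, ih (h.2.quotSMulTop_pow h.1 n)⟩

section Local

variable [IsLocalRing R] [IsNoetherianRing R]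

/-- A linear map that is injective modulo a sequence weakly regular on the target is injective. -/
lemma injective_of_injective_mod_of_isWeaklyRegular [Module.Finite R A] {xs : List R}
    (hxs : ∀ x ∈ xs, x ∈ maximalIdeal R) (f : A →ₗ[R] B) (hB : IsWeaklyRegular B xs)
    (h : ∀ a, f a ∈ (Ideal.ofList xs • ⊤ : Submodule R B) →
      a ∈ (Ideal.ofList xs • ⊤ : Submodule R A)) :
    Injective f ∧ IsWeaklyRegular A xs := by
  induction xs generalizing A B with
  | nil =>
    refine ⟨(injective_iff_map_eq_zero f).2 fun a ha => ?_, .nil R A⟩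
    simpa [Ideal.ofList_nil] using h a (by simp [ha])
  | cons r rs ih =>
    rw [isWeaklyRegular_cons_iff] at hB ⊢
    simp only [List.mem_cons, forall_eq_or_imp] at hxs
    obtain ⟨hinj, hreg⟩ := ih hxs.2 (QuotSMulTop.map r f) hB.2 (by
      intro a
      obtain ⟨a, rfl⟩ := Submodule.mkQ_surjective _ a
      rw [Submodule.mkQ_apply, QuotSMulTop.map_apply_mk, mk_mem_ofList_smul_top_iff,
        mk_mem_ofList_smul_top_iff]
      exact h a)
    have hf : Injective f := by
      rw [← LinearMap.ker_eq_bot]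
      refine Submodule.eq_bot_of_le_smul_of_le_jacobson_bot (Ideal.span {r}) _
        (IsNoetherian.noetherian _) ?_ ?_
      · intro a ha
        have h0 : (Submodule.Quotient.mk a : QuotSMulTop r A) = 0 := hinj (by
          rw [QuotSMulTop.map_apply_mk, LinearMap.mem_ker.1 ha, map_zero]; rfl)
        rw [Submodule.Quotient.mk_eq_zero, Submodule.mem_smul_pointwise_iff_exists] at h0
        obtain ⟨b, -, rfl⟩ := h0
        refine Submodule.smul_mem_smul (Ideal.mem_span_singleton_self r) ?_
        exact LinearMap.mem_ker.2 (hB.1 (by simpa using ha))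
      · rw [IsLocalRing.jacobson_eq_maximalIdeal _ bot_ne_top]
        simpa [Ideal.span_le] using hxs.1
    exact ⟨hf, hB.1.of_injective f hf, hreg⟩

end Local

lemma coheight_le_supportDim {R : Type*} [CommRing R] {M : Type*} [AddCommGroup M]
    [Module R M] {P : PrimeSpectrum R} (hP : P ∈ Module.support R M) :
    (Order.coheight P : WithBot ℕ∞) ≤ Module.supportDim R M := by
  rw [Order.coheight_eq_krullDim_Ici]
  exact Order.krullDim_le_of_strictMono
    (fun Q => ⟨Q.1, Module.mem_support_mono Q.2 hP⟩) fun _ _ h => h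

lemma maximalIdeal_smul_top_lt_top {R : Type*} [CommRing R] [IsLocalRing R] {M : Type*}
    [AddCommGroup M] [Module R M] [Nontrivial M] [Module.Finite R M] :
    maximalIdeal R • (⊤ : Submodule R M) < ⊤ :=
  (Submodule.top_ne_ideal_smul_of_le_jacobson_annihilator
    (IsLocalRing.maximalIdeal_le_jacobson _)).symm.lt_top

section Depth

variable {R : Type*} [CommRing R] [IsNoetherianRing R] [IsLocalRing R]
  {M : Type*} [AddCommGroup M] [Module R M] [Module.Finite R M]

/-- Every associated prime of `M` is strictly contained in an associated prime of `M / xM`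
when `x` is an `M`-regular element of the maximal ideal. -/
lemma exists_lt_mem_associatedPrimes_quotSMulTop {x : R} (hx : x ∈ maximalIdeal R)
    (hreg : IsSMulRegular M x) {P : Ideal R} (hP : P ∈ associatedPrimes R M) :
    ∃ Q ∈ associatedPrimes R (QuotSMulTop x M), P < Q := by
  obtain ⟨hPp, m, hm⟩ := isAssociatedPrime_iff.1 (AssociatedPrimes.mem_iff.1 hP)
  have hPm : ∀ r, r ∈ P ↔ r • m = 0 := fun r => by
    rw [hm]; simp [Submodule.mem_colon_singleton]
  have hm0 : m ≠ 0 := fun h => hPp.ne_top (by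
    rw [Ideal.eq_top_iff_one, hPm, h, smul_zero])
  have hxP : x ∉ P := fun h => hm0 (hreg (by simpa using (hPm x).1 h))
  let T : Submodule R M := torsionBySet R M P
  have hT : ∃ t ∈ T, t ∉ (x • ⊤ : Submodule R M) := by
    by_contra! hcon
    have : T = ⊥ := by
      refine Submodule.eq_bot_of_le_smul_of_le_jacobson_bot (Ideal.span {x}) _
        (IsNoetherian.noetherian _) ?_ ?_
      · intro t ht
        obtain ⟨s, -, rfl⟩ := (Submodule.mem_smul_pointwise_iff_exists _ _ _).1 (hcon t ht)
        refine Submodule.smul_mem_smul (Ideal.mem_span_singleton_self x) ?_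
        rw [Submodule.mem_torsionBySet_iff] at ht ⊢
        intro a
        refine hreg ?_
        simpa [smul_comm x] using ht a
      · rw [IsLocalRing.jacobson_eq_maximalIdeal _ bot_ne_top]
        simpa [Ideal.span_le] using hx
    have hmT : m ∈ T := by
      rw [Submodule.mem_torsionBySet_iff]
      exact fun a => (hPm a).1 a.2
    rw [this] at hmT
    exact hm0 hmT
  obtain ⟨t, htT, ht⟩ := hT
  have ht0 : (Submodule.Quotient.mk t : QuotSMulTop x M) ≠ 0 := by
    rwa [ne_eq, Submodule.Quotient.mk_eq_zero]
  obtain ⟨Q, hQ, hle⟩ := exists_le_isAssociatedPrime_of_isNoetherianRing R _ ht0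
  have hQ' : ∀ r, (Submodule.Quotient.mk (r • t) : QuotSMulTop x M) = 0 → r ∈ Q := fun r hr =>
    hle (by simpa [Submodule.mem_colon_singleton] using hr)
  refine ⟨Q, hQ, lt_of_le_of_ne (fun r hr => hQ' r ?_) ?_⟩
  · rw [Submodule.mem_torsionBySet_iff] at htT
    rw [htT ⟨r, hr⟩]; rfl
  · rintro rfl
    refine hxP (hQ' x ?_)
    rw [Submodule.Quotient.mk_eq_zero]
    exact Submodule.smul_mem_pointwise_smul _ _ _ trivial

/-- The length of an `M`-regular sequence is at most `dim R / P` for every `P ∈ Ass M`. -/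
lemma length_le_coheight_of_mem_associatedPrimes {zs : List R}
    (hz : ∀ z ∈ zs, z ∈ maximalIdeal R) (hreg : IsWeaklyRegular M zs) {P : PrimeSpectrum R}
    (hP : P.asIdeal ∈ associatedPrimes R M) : (zs.length : ℕ∞) ≤ Order.coheight P := by
  induction zs generalizing M P with
  | nil => simp
  | cons z zs ih =>
    simp only [List.mem_cons, forall_eq_or_imp] at hz
    rw [isWeaklyRegular_cons_iff] at hreg
    obtain ⟨Q, hQ, hlt⟩ := exists_lt_mem_associatedPrimes_quotSMulTop hz.1 hreg.1 hP
    have := ih hz.2 hreg.2 (P := ⟨Q, hQ.isPrime⟩) hQ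
    have hlt' : P < ⟨Q, hQ.isPrime⟩ := hlt
    refine le_trans ?_ (Order.coheight_add_one_le hlt')
    simpa using this

lemma supportDim_le_supportDim_quotient_ofList_add_length {ys : List R}
    (hy : ∀ y ∈ ys, y ∈ maximalIdeal R) : Module.supportDim R M ≤
      Module.supportDim R (M ⧸ (Ideal.ofList ys • ⊤ : Submodule R M)) + ys.length := by
  induction ys generalizing M with
  | nil =>
    rw [Ideal.ofList_nil, Submodule.bot_smul]
    simpa using (Module.supportDim_eq_of_equiv
      (Submodule.quotEquivOfEqBot (⊥ : Submodule R M) rfl)).ge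
  | cons y ys ih =>
    simp only [List.mem_cons, forall_eq_or_imp] at hy
    refine (Module.supportDim_le_supportDim_quotSMulTop_succ hy.1).trans ?_
    rw [Module.supportDim_eq_of_equiv
      (Submodule.quotOfListConsSMulTopEquivQuotSMulTopInner M y ys), List.length_cons,
      Nat.cast_add, Nat.cast_one, ← add_assoc]
    gcongr
    exact ih hy.2

end Depth

section CohenMacaulay

variable {R : Type u} [CommRing R] [IsNoetherianRing R] [IsLocalRing R]
  {M : Type u} [AddCommGroup M] [Module R M] [Module.Finite R M]

lemma exists_isRegular_quotSMulTop [Nontrivial M] {y : R} (hy : y ∈ maximalIdeal R)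
    (hreg : IsSMulRegular M y) {zs : List R} (hz : ∀ z ∈ zs, z ∈ maximalIdeal R)
    (hzs : IsRegular M zs) {n : ℕ} (hn : zs.length = n + 1) :
    ∃ rs : List R, rs.length = n ∧ (∀ r ∈ rs, r ∈ maximalIdeal R) ∧
      IsRegular (QuotSMulTop y M) rs := by
  have : Nontrivial (QuotSMulTop y M) := nontrivial_quotSMulTop_of_mem_maximalIdeal M hy
  have h1 := ((ModuleCat.exists_isRegular_tfae (maximalIdeal R) (n + 1) (ModuleCat.of R M)
    maximalIdeal_smul_top_lt_top).out 3 1 :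
      (∃ rs : List R, rs.length = n + 1 ∧ (∀ r ∈ rs, r ∈ maximalIdeal R) ∧ IsRegular M rs) ↔ _).1
      ⟨zs, hn, hz, hzs⟩
  refine ((ModuleCat.exists_isRegular_tfae (maximalIdeal R) n (ModuleCat.of R (QuotSMulTop y M))
    maximalIdeal_smul_top_lt_top).out 1 3).1 fun i hi => ?_
  have zero1 := AddCommGrpCat.isZero_of_iff_subsingleton.mpr (h1 i (by omega))
  have zero2 := AddCommGrpCat.isZero_of_iff_subsingleton.mpr (h1 (i + 1) (by omega))
  exact AddCommGrpCat.subsingleton_of_isZero <| ShortComplex.Exact.isZero_of_both_zeros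
    ((Abelian.Ext.covariant_sequence_exact₃' _
      (IsSMulRegular.smulShortComplex_shortExact (M := ModuleCat.of R M) hreg)) i (i + 1) rfl)
    (zero1.eq_zero_of_src _) (zero2.eq_zero_of_tgt _)

/-- If `M` has a regular sequence of length `n`, then every sequence of length `n` modulo which
`M` has dimension at most zero is regular on `M`. -/
theorem isWeaklyRegular_of_supportDim_quotient_le_zero {zs ys : List R}
    (hz : ∀ z ∈ zs, z ∈ maximalIdeal R) (hzs : IsWeaklyRegular M zs)
    (hy : ∀ y ∈ ys, y ∈ maximalIdeal R) (hlen : ys.length = zs.length)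
    (hdim : Module.supportDim R (M ⧸ (Ideal.ofList ys • ⊤ : Submodule R M)) ≤ 0) :
    IsWeaklyRegular M ys := by
  induction ys generalizing M zs with
  | nil => exact .nil R M
  | cons y ys ih =>
    rcases subsingleton_or_nontrivial M with hM | hM
    · exact ⟨fun i h => fun a b _ => Subsingleton.elim _ _⟩
    simp only [List.mem_cons, forall_eq_or_imp] at hy
    rw [Module.supportDim_eq_of_equiv
      (Submodule.quotOfListConsSMulTopEquivQuotSMulTopInner M y ys)] at hdim
    have hle := supportDim_le_supportDim_quotient_ofList_add_length (M := QuotSMulTop y M) hy.2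
    have hle' : Module.supportDim R (QuotSMulTop y M) ≤ ys.length :=
      hle.trans (by simpa using add_le_add_left hdim (ys.length : WithBot ℕ∞))
    have hreg : IsSMulRegular M y := by
      by_contra hcon
      have hmem : y ∈ ⋃ p ∈ associatedPrimes R M, (p : Set R) := by
        rw [biUnion_associatedPrimes_eq_compl_regular]; exact hcon
      simp only [Set.mem_iUnion, exists_prop] at hmem
      obtain ⟨P, hP, hyP⟩ := hmem
      have hPs : (⟨P, hP.isPrime⟩ : PrimeSpectrum R) ∈ Module.support R (QuotSMulTop y M) := by
        rw [Module.support_quotSMulTop]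
        refine ⟨?_, by simpa using hyP⟩
        rw [Module.mem_support_iff_of_finite]
        rw [← Submodule.annihilator_top]
        exact IsAssociatedPrime.annihilator_le hP
      have h1 := length_le_coheight_of_mem_associatedPrimes hz hzs (P := ⟨P, hP.isPrime⟩) hP
      have h2 := (coheight_le_supportDim hPs).trans hle'
      rw [← hlen] at h1
      have h3 : ((List.length (y :: ys) : ℕ∞) : WithBot ℕ∞) ≤ (ys.length : ℕ∞) :=
        (WithBot.coe_le_coe.2 h1).trans h2
      have h4 := WithBot.coe_le_coe.1 h3
      rw [Nat.cast_le] at h4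
      simp at h4
    obtain ⟨rs, hrs, hrm, hrr⟩ := exists_isRegular_quotSMulTop hy.1 hreg hz
      ((isRegular_iff_isWeaklyRegular_of_subset_maximalIdeal hz).2 hzs)
      (n := ys.length) (by simpa using hlen.symm)
    exact .cons hreg (ih hrm hrr.1 hy.2 hrs.symm hdim)

end CohenMacaulay

end RingTheory.Sequence

open scoped TensorProduct Pointwise
open Function

section FourTerm

variable {R : Type*} [CommRing R]
variable {A B C : Type*} [AddCommGroup A] [AddCommGroup B] [AddCommGroup C]
  [Module R A] [Module R B] [Module R C]
variable {T' G T : Type*} [AddCommGroup T'] [AddCommGroup G] [AddCommGroup T]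
  [Module R T'] [Module R G] [Module R T]

lemma LinearMap.lTensor_rTensor_comm_apply (f : A →ₗ[R] B) (g : T' →ₗ[R] G) (x : A ⊗[R] T') :
    g.lTensor B (f.rTensor T' x) = f.rTensor G (g.lTensor A x) := by
  rw [← LinearMap.comp_apply, ← LinearMap.comp_apply, LinearMap.lTensor_comp_rTensor,
    LinearMap.rTensor_comp_lTensor]

/-- The two ways of computing the vanishing of `Tor₁(C, T)`: from an extension `A → B → C` and
from an extension `T' → G → T`, provided that `Tor₁(B, T) = 0` and `G` is flat. -/
lemma lTensor_injective_iff_rTensor_injective [Module.Flat R G]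
    {f : A →ₗ[R] B} {g : B →ₗ[R] C} (hf : Injective f) (hfg : Exact f g) (hg : Surjective g)
    {ι : T' →ₗ[R] G} {π : G →ₗ[R] T} (hιπ : Exact ι π) (hπ : Surjective π)
    (hB : Injective (ι.lTensor B)) :
    Injective (ι.lTensor C) ↔ Injective (f.rTensor T) := by
  have hfG : Injective (f.rTensor G) := Module.Flat.rTensor_preserves_injective_linearMap f hf
  constructor
  · intro h
    rw [injective_iff_map_eq_zero] at h ⊢
    intro z hz
    obtain ⟨w, rfl⟩ := LinearMap.lTensor_surjective A hπ z
    rw [← LinearMap.lTensor_rTensor_comm_apply] at hz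
    obtain ⟨v, hv⟩ := (lTensor_exact B hιπ hπ _).1 hz
    have hgv : g.rTensor T' v = 0 := h _ <| by
      rw [LinearMap.lTensor_rTensor_comm_apply, hv]
      exact (rTensor_exact G hfg hg _).2 ⟨w, rfl⟩
    obtain ⟨v', rfl⟩ := (rTensor_exact T' hfg hg _).1 hgv
    rw [LinearMap.lTensor_rTensor_comm_apply] at hv
    rw [← hfG hv]
    exact (lTensor_exact A hιπ hπ _).2 ⟨v', rfl⟩
  · intro h
    rw [injective_iff_map_eq_zero] at h ⊢
    intro z hz
    obtain ⟨v, rfl⟩ := LinearMap.rTensor_surjective T' hg z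
    rw [LinearMap.lTensor_rTensor_comm_apply] at hz
    obtain ⟨w, hw⟩ := (rTensor_exact G hfg hg _).1 hz
    have hπw : π.lTensor A w = 0 := h _ <| by
      rw [← LinearMap.lTensor_rTensor_comm_apply, hw]
      exact (lTensor_exact B hιπ hπ _).2 ⟨v, rfl⟩
    obtain ⟨v', rfl⟩ := (lTensor_exact A hιπ hπ _).1 hπw
    rw [← LinearMap.lTensor_rTensor_comm_apply] at hw
    exact (rTensor_exact T' hfg hg _).2 ⟨v', hB hw⟩

end FourTerm

section TorVanishing

variable (R : Type u) [CommRing R]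

/-- The free module on the elements of `T`. -/
def FreeCover (T : Type u) : Type u := T →₀ R

noncomputable instance (T : Type u) : AddCommGroup (FreeCover R T) :=
  inferInstanceAs (AddCommGroup (T →₀ R))

noncomputable instance (T : Type u) : Module R (FreeCover R T) :=
  inferInstanceAs (Module R (T →₀ R))

instance (T : Type u) : Module.Free R (FreeCover R T) :=
  inferInstanceAs (Module.Free R (T →₀ R))

section

variable (T : Type u) [AddCommGroup T] [Module R T]

/-- The canonical surjection from the free module on `T` to `T`. -/
noncomputable def FreeCover.toModule : FreeCover R T →ₗ[R] T :=
  Finsupp.linearCombination R (id : T → T)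

lemma FreeCover.toModule_surjective : Function.Surjective (FreeCover.toModule R T) :=
  Finsupp.linearCombination_id_surjective R T

/-- The kernel of the canonical surjection from the free module on `T` to `T`. -/
def FreeSyzygy : Type u := LinearMap.ker (FreeCover.toModule R T)

noncomputable instance : AddCommGroup (FreeSyzygy R T) :=
  inferInstanceAs (AddCommGroup (LinearMap.ker (FreeCover.toModule R T)))

noncomputable instance : Module R (FreeSyzygy R T) :=
  inferInstanceAs (Module R (LinearMap.ker (FreeCover.toModule R T)))

/-- The inclusion of the syzygy module into the free module. -/
noncomputable def FreeSyzygy.incl : FreeSyzygy R T →ₗ[R] FreeCover R T :=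
  (LinearMap.ker (FreeCover.toModule R T)).subtype

lemma FreeSyzygy.incl_injective : Function.Injective (FreeSyzygy.incl R T) :=
  Submodule.injective_subtype _

lemma FreeSyzygy.exact : Function.Exact (FreeSyzygy.incl R T) (FreeCover.toModule R T) :=
  LinearMap.exact_subtype_ker_map _

end

/-- `TorSuccVanishes R N j T` expresses `Tor_{j + 1}(N, T) = 0`, computed by resolving `T`. -/
def TorSuccVanishes (N : Type*) [AddCommGroup N] [Module R N] :
    ℕ → ∀ (T : Type u) [AddCommGroup T] [Module R T], Prop
  | 0, T, _, _ => Function.Injective ((FreeSyzygy.incl R T).lTensor N)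
  | j + 1, T, _, _ => TorSuccVanishes N j (FreeSyzygy R T)

variable {R}

lemma torSuccVanishes_zero_def (N : Type*) [AddCommGroup N] [Module R N]
    (T : Type u) [AddCommGroup T] [Module R T] :
    TorSuccVanishes R N 0 T ↔ Function.Injective ((FreeSyzygy.incl R T).lTensor N) := by
  rw [TorSuccVanishes]

lemma torSuccVanishes_succ_def (N : Type*) [AddCommGroup N] [Module R N] (j : ℕ)
    (T : Type u) [AddCommGroup T] [Module R T] :
    TorSuccVanishes R N (j + 1) T ↔ TorSuccVanishes R N j (FreeSyzygy R T) := by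
  rw [TorSuccVanishes]

lemma TorSuccVanishes.of_flat (N : Type*) [AddCommGroup N] [Module R N] [Module.Flat R N] (j : ℕ)
    (T : Type u) [AddCommGroup T] [Module R T] : TorSuccVanishes R N j T := by
  induction j generalizing T with
  | zero =>
    rw [torSuccVanishes_zero_def]
    exact Module.Flat.lTensor_preserves_injective_linearMap _ (FreeSyzygy.incl_injective R T)
  | succ j ih => exact (torSuccVanishes_succ_def _ _ _).2 (ih _)

variable {A B C : Type*} [AddCommGroup A] [AddCommGroup B] [AddCommGroup C]
  [Module R A] [Module R B] [Module R C]

lemma TorSuccVanishes.congr (e : A ≃ₗ[R] B) {j : ℕ} {T : Type u} [AddCommGroup T] [Module R T]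
    (h : TorSuccVanishes R A j T) : TorSuccVanishes R B j T := by
  induction j generalizing T with
  | zero =>
    rw [torSuccVanishes_zero_def, injective_iff_map_eq_zero] at h ⊢
    intro x hx
    obtain ⟨x, rfl⟩ := (e.rTensor (FreeSyzygy R T)).surjective x
    have : x = 0 := h x <| (e.rTensor (FreeCover R T)).injective <| by
      rw [map_zero]
      exact (LinearMap.lTensor_rTensor_comm_apply e.toLinearMap _ x).symm.trans hx
    rw [this, map_zero]
  | succ j ih =>
    rw [torSuccVanishes_succ_def] at h ⊢
    exact ih h

lemma torSuccVanishes_zero_iff {f : A →ₗ[R] B} {g : B →ₗ[R] C} (hf : Injective f)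
    (hfg : Exact f g) (hg : Surjective g) {T : Type u} [AddCommGroup T] [Module R T]
    (hB : TorSuccVanishes R B 0 T) :
    TorSuccVanishes R C 0 T ↔ Injective (f.rTensor T) := by
  rw [torSuccVanishes_zero_def] at hB ⊢
  exact lTensor_injective_iff_rTensor_injective hf hfg hg
    (FreeSyzygy.exact R T) (FreeCover.toModule_surjective R T) hB

/-- Dimension shifting. -/
lemma torSuccVanishes_succ_iff {f : A →ₗ[R] B} {g : B →ₗ[R] C} (hf : Injective f)
    (hfg : Exact f g) (hg : Surjective g) {T : Type u} [AddCommGroup T] [Module R T]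
    (hB : ∀ j, TorSuccVanishes R B j T) (j : ℕ) :
    TorSuccVanishes R C (j + 1) T ↔ TorSuccVanishes R A j T := by
  induction j generalizing T with
  | zero =>
    rw [torSuccVanishes_succ_def, torSuccVanishes_zero_iff hf hfg hg
      ((torSuccVanishes_succ_def _ _ _).1 (hB 1)), torSuccVanishes_zero_def]
    have hfG : Injective (f.rTensor (FreeCover R T)) :=
      Module.Flat.rTensor_preserves_injective_linearMap f hf
    have hB0 : Injective ((FreeSyzygy.incl R T).lTensor B) :=
      (torSuccVanishes_zero_def _ _).1 (hB 0)
    rw [← hB0.of_comp_iff (f.rTensor (FreeSyzygy R T)),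
      ← hfG.of_comp_iff ((FreeSyzygy.incl R T).lTensor A)]
    refine iff_of_eq (congrArg _ (funext fun x => ?_))
    exact LinearMap.lTensor_rTensor_comm_apply f _ x
  | succ j ih =>
    rw [torSuccVanishes_succ_def, torSuccVanishes_succ_def]
    exact ih fun j => (torSuccVanishes_succ_def _ _ _).1 (hB (j + 1))

open RingTheory.Sequence in
/-- Killing a sequence that is regular on `N` and on `N ⊗ T` preserves the vanishing of
`Tor(N, T)`. -/
lemma TorSuccVanishes.quotient_ofList {N : Type*} [AddCommGroup N] [Module R N] {T : Type u}
    [AddCommGroup T] [Module R T] (hN : ∀ j, TorSuccVanishes R N j T) {xs : List R}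
    (hx : IsWeaklyRegular N xs) (hxT : IsWeaklyRegular (N ⊗[R] T) xs) (j : ℕ) :
    TorSuccVanishes R (N ⧸ (Ideal.ofList xs • ⊤ : Submodule R N)) j T := by
  induction xs generalizing N j with
  | nil =>
    exact (hN j).congr (Submodule.quotEquivOfEqBot _ (by simp [Ideal.ofList_nil])).symm
  | cons x xs ih =>
    rw [isWeaklyRegular_cons_iff] at hx hxT
    refine TorSuccVanishes.congr
      (Submodule.quotOfListConsSMulTopEquivQuotSMulTopInner N x xs).symm
      (ih (fun j => ?_) hx.2 ?_ j)
    · have hf : Injective (LinearMap.lsmul R N x) := hx.1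
      have hfg := LinearMap.exact_lsmul_mkQ_smul_top N x
      have hg := Submodule.mkQ_surjective (x • (⊤ : Submodule R N))
      cases j with
      | zero =>
        refine (torSuccVanishes_zero_iff hf hfg hg (hN 0)).2 ?_
        have : (LinearMap.lsmul R N x).rTensor T = LinearMap.lsmul R (N ⊗[R] T) x := by
          ext a b; simp [TensorProduct.smul_tmul']
        rw [this]
        exact hxT.1
      | succ j => exact (torSuccVanishes_succ_iff hf hfg hg hN j).2 (hN j)
    · exact ((QuotSMulTop.quotSMulTopTensorEquivQuotSMulTop x T N).isWeaklyRegular_congr xs).2 hxT.2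

/-- Vanishing of `Tor` computed from a flat resolution of the first argument. -/
lemma torSuccVanishes_iff_exact {N : Type u} [AddCommGroup N] [Module R N] {T : Type u}
    [AddCommGroup T] [Module R T] {P : ℕ → Type u} [∀ i, AddCommGroup (P i)] [∀ i, Module R (P i)]
    [∀ i, Module.Flat R (P i)] (d : ∀ i, P (i + 1) →ₗ[R] P i) (π : P 0 →ₗ[R] N)
    (hd : ∀ i, Exact (d (i + 1)) (d i)) (hdπ : Exact (d 0) π) (hπ : Surjective π) (j : ℕ) :
    Exact ((d (j + 1)).rTensor T) ((d j).rTensor T) ↔ TorSuccVanishes R N j T := by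
  let π' : P 1 →ₗ[R] LinearMap.ker π :=
    (d 0).codRestrict (LinearMap.ker π) fun x => (hdπ _).2 ⟨x, rfl⟩
  have hπ' : Surjective π' := fun ⟨y, hy⟩ => by
    obtain ⟨x, hx⟩ := (hdπ y).1 hy
    exact ⟨x, Subtype.ext hx⟩
  have hdπ' : Exact (d 1) π' := fun x => by
    rw [← hd 0 x]
    exact ⟨fun h => congrArg Subtype.val h, fun h => Subtype.ext h⟩
  have hker := LinearMap.exact_subtype_ker_map π
  have hsub := Submodule.injective_subtype (LinearMap.ker π)
  induction j generalizing N P with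
  | zero =>
    rw [torSuccVanishes_zero_iff hsub hker hπ (TorSuccVanishes.of_flat _ _ _)]
    have hcomp : ∀ w, (d 0).rTensor T w =
        (LinearMap.ker π).subtype.rTensor T (π'.rTensor T w) := fun w => by
      rw [← LinearMap.comp_apply, ← LinearMap.rTensor_comp]; rfl
    constructor
    · intro h
      rw [injective_iff_map_eq_zero]
      intro z hz
      obtain ⟨w, rfl⟩ := LinearMap.rTensor_surjective T hπ' z
      rw [← hcomp] at hz
      exact (rTensor_exact T hdπ' hπ' w).2 ((h w).1 hz)
    · intro h w
      rw [hcomp, map_eq_zero_iff _ h]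
      exact rTensor_exact T hdπ' hπ' w
  | succ j ih =>
    rw [torSuccVanishes_succ_iff hsub hker hπ fun j => TorSuccVanishes.of_flat _ _ _]
    refine ih (P := fun i => P (i + 1)) (fun i => d (i + 1)) π' (fun i => hd (i + 1)) hdπ' hπ'
      ?_ ?_ ?_ ?_
    · intro ⟨y, hy⟩
      obtain ⟨x, hx⟩ := (hdπ' y).1 hy
      exact ⟨x, Subtype.ext hx⟩
    · intro x
      rw [← hd 1 x]
      exact ⟨fun h => congrArg Subtype.val h, fun h => Subtype.ext h⟩
    · exact LinearMap.exact_subtype_ker_map π'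
    · exact Submodule.injective_subtype _

end TorVanishing

open MonoidalCategory in
lemma isZero_tor'_succ_iff {R : Type u} [CommRing R] (N T : ModuleCat.{u} R) (j : ℕ) :
    Limits.IsZero (((Tor' (ModuleCat.{u} R) (j + 1)).obj N).obj T) ↔ TorSuccVanishes R N j T := by
  let P := ProjectiveResolution.of N
  have hflat : ∀ i, Module.Flat R (P.complex.X i) := fun i =>
    have : Module.Projective R (P.complex.X i) :=
      (IsProjective.iff_projective _).2 (P.projective i)
    inferInstance
  rw [Tor'_obj_obj, (P.isoLeftDerivedObj ((tensoringRight (ModuleCat.{u} R)).obj T)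
    (j + 1)).isZero_iff, HomologicalComplex.homologyFunctor_obj,
    ← HomologicalComplex.exactAt_iff_isZero_homology,
    HomologicalComplex.exactAt_iff' _ (j + 2) (j + 1) j (by simp) (by simp)]
  rw [ShortComplex.ShortExact.moduleCat_exact_iff_function_exact]
  refine Iff.trans (Iff.rfl) (torSuccVanishes_iff_exact (P := fun i => P.complex.X i)
    (fun i => (P.complex.d (i + 1) i).hom) (P.π.f 0).hom ?_ ?_ ?_ j)
  · intro i
    have := P.complex_exactAt_succ i
    rw [HomologicalComplex.exactAt_iff' _ (i + 2) (i + 1) i (by simp) (by simp),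
      ShortComplex.ShortExact.moduleCat_exact_iff_function_exact] at this
    exact this
  · have := P.exact₀
    rw [ShortComplex.ShortExact.moduleCat_exact_iff_function_exact] at this
    exact this
  · exact (ModuleCat.epi_iff_surjective _).1 inferInstance

namespace Matrix

variable {R : Type*} [CommRing R] {m : Type*} {b : ℕ}

/-- **McCoy's theorem**: the maximal minors of an injective matrix have no common annihilator. -/
theorem eq_zero_of_forall_mul_det_submatrix_eq_zero {A : Matrix m (Fin b) R}
    (hA : Function.Injective A.mulVec) {a : R}
    (ha : ∀ f : Fin b → m, a * (A.submatrix f id).det = 0) : a = 0 := by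
  suffices h : ∀ r ≤ b, ∀ (f : Fin r → m) (g : Fin r → Fin b), a * (A.submatrix f g).det = 0 by
    simpa using h 0 (Nat.zero_le _) Fin.elim0 Fin.elim0
  intro r hr
  induction hr using Nat.decreasingInduction with
  | self =>
    intro f g
    by_cases hg : Function.Injective g
    · let σ : Equiv.Perm (Fin b) := Equiv.ofBijective g (Finite.injective_iff_bijective.1 hg)
      have : A.submatrix f g = (A.submatrix f id).submatrix id σ := rfl
      rw [this, det_permute', mul_left_comm, ha, mul_zero]
    · obtain ⟨i, j, hij, hne⟩ := by simpa [Function.Injective] using hg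
      rw [det_zero_of_column_eq hne (by simp [hij]), mul_zero]
  | of_succ r hr ih =>
    intro f g
    have hns : ¬ Function.Surjective g := fun hg => by
      have := Fintype.card_le_of_surjective g hg
      simp at this
      omega
    obtain ⟨j₀, hj₀⟩ := by simpa [Function.Surjective] using hns
    let g' : Fin (r + 1) → Fin b := Fin.cons j₀ g
    let c : Fin (r + 1) → R := fun j =>
      (-1) ^ (j : ℕ) * (a * (A.submatrix f (g' ∘ j.succAbove)).det)
    let v : Fin b → R := ∑ j, Pi.single (g' j) (c j)
    have hv : A.mulVec v = A.mulVec 0 := by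
      ext i
      have := ih (Fin.cons i f) g'
      rw [det_succ_row_zero, Finset.mul_sum] at this
      simp only [v, mulVec_zero, Pi.zero_apply, mulVec_sum, Finset.sum_apply, mulVec_single]
      rw [← this]
      refine Finset.sum_congr rfl fun j _ => ?_
      have hsub : (A.submatrix (Fin.cons i f) g').submatrix Fin.succ j.succAbove =
          A.submatrix f (g' ∘ j.succAbove) := by
        ext k l; simp
      rw [hsub]
      simp [c]
      ring
    have h0 : (∑ j, Pi.single (g' j) (c j) : Fin b → R) j₀ = 0 := congrFun (hA hv) j₀
    rw [Finset.sum_apply, Fin.sum_univ_succ] at h0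
    have hg' : ∀ k : Fin r, g' k.succ = g k := fun k => rfl
    have hg0 : g' 0 = j₀ := rfl
    rw [Finset.sum_eq_zero (fun k _ => by
      rw [hg', Pi.single_eq_of_ne fun h => hj₀ k h.symm]), hg0, Pi.single_eq_same, add_zero] at h0
    have hc : g' ∘ Fin.succAbove 0 = g := funext fun k => rfl
    simp only [c, hc] at h0
    simpa using h0

/-- A maximal minor annihilates a vector modulo any ideal that contains the entries of its
image. -/
lemma det_submatrix_mul_mem {A : Matrix m (Fin b) R} {I : Ideal R} {v : Fin b → R}
    (hv : ∀ i, A.mulVec v i ∈ I) (f : Fin b → m) (j : Fin b) :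
    (A.submatrix f id).det * v j ∈ I := by
  have h : ((A.submatrix f id).adjugate.mulVec ((A.submatrix f id).mulVec v)) j =
      (A.submatrix f id).det * v j := by
    rw [mulVec_mulVec, adjugate_mul, smul_mulVec, one_mulVec]; rfl
  rw [← h, mulVec, dotProduct]
  refine Ideal.sum_mem I fun k _ => I.mul_mem_left _ ?_
  exact hv (f k)

/-- Let `φ` be a ring endomorphism such that every `r` divides `φ r`. If applying `φ` to the
entries of a matrix makes it injective, then the matrix is injective. -/
theorem mulVec_injective_of_map_injective (φ : R →+* R) (hφ : ∀ r, r ∣ φ r)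
    {A : Matrix m (Fin b) R} (hA : Function.Injective (A.map φ).mulVec) :
    Function.Injective A.mulVec := by
  intro v w hvw
  ext j
  rw [← sub_eq_zero]
  refine eq_zero_of_forall_mul_det_submatrix_eq_zero hA fun f => ?_
  have h1 : (A.submatrix f id).det * (v - w) j ∈ (⊥ : Ideal R) :=
    det_submatrix_mul_mem (by simp [mulVec_sub, hvw]) f j
  have h2 : ((A.map φ).submatrix f id).det = φ (A.submatrix f id).det := by
    rw [RingHom.map_det]; rfl
  obtain ⟨c, hc⟩ := hφ (A.submatrix f id).det
  rw [h2, hc]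
  rw [Ideal.mem_bot, Pi.sub_apply] at h1
  linear_combination c * h1

end Matrix

open RingTheory.Sequence

section BaseChange

variable {R : Type*} [CommRing R] {S : Type*} [CommRing S] [Algebra R S]
variable {A B C : Type*} [AddCommGroup A] [AddCommGroup B] [AddCommGroup C]
  [Module R A] [Module R B] [Module R C]

lemma tmul_mem_map_smul_top {I : Ideal R} {a : A} (ha : a ∈ (I • ⊤ : Submodule R A)) (s : S) :
    s ⊗ₜ[R] a ∈ (I.map (algebraMap R S) • ⊤ : Submodule S (S ⊗[R] A)) := by
  refine Submodule.smul_induction_on ha (fun r hr a _ => ?_) fun a b ha hb => ?_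
  · rw [TensorProduct.tmul_smul, ← algebraMap_smul S r]
    exact Submodule.smul_mem_smul (Ideal.mem_map_of_mem _ hr) trivial
  · rw [TensorProduct.tmul_add]
    exact add_mem ha hb

lemma baseChange_mkQ_eq_zero_iff (I : Ideal R) (e : S ⊗[R] A) :
    (I • ⊤ : Submodule R A).mkQ.lTensor S e = 0 ↔
      e ∈ (I.map (algebraMap R S) • ⊤ : Submodule S (S ⊗[R] A)) := by
  constructor
  · intro h
    obtain ⟨w, rfl⟩ := (lTensor_exact S (f := (I • ⊤ : Submodule R A).subtype)
      (LinearMap.exact_subtype_mkQ _) (Submodule.mkQ_surjective _) e).1 h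
    induction w with
    | zero => simp
    | tmul s a =>
      rw [LinearMap.lTensor_tmul]
      exact tmul_mem_map_smul_top a.2 s
    | add x y hx hy =>
      rw [map_add] at h ⊢
      refine add_mem (hx ?_) (hy ?_) <;>
      · rw [← LinearMap.comp_apply, ← LinearMap.lTensor_comp,
          LinearMap.exact_subtype_mkQ _ |>.linearMap_comp_eq_zero]; simp
  · intro h
    have hle : (I.map (algebraMap R S) • ⊤ : Submodule S (S ⊗[R] A)) ≤
        LinearMap.ker ((I • ⊤ : Submodule R A).mkQ.baseChange S) := by
      rw [Submodule.smul_le]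
      intro r hr x _
      have hx : I.map (algebraMap R S) ≤ LinearMap.ker (LinearMap.toSpanSingleton S _
          ((I • ⊤ : Submodule R A).mkQ.baseChange S x)) := by
        rw [Ideal.map_le_iff_le_comap]
        intro i hi
        rw [Ideal.mem_comap, LinearMap.mem_ker, LinearMap.toSpanSingleton_apply, algebraMap_smul,
          ← LinearMap.map_smul_of_tower]
        induction x with
        | zero => simp
        | tmul s a =>
          rw [← TensorProduct.tmul_smul, LinearMap.baseChange_tmul, Submodule.mkQ_apply,
            (Submodule.Quotient.mk_eq_zero _).2 (Submodule.smul_mem_smul hi Submodule.mem_top),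
            TensorProduct.tmul_zero]
        | add x y hx hy => rw [smul_add, map_add, hx trivial, hy trivial, add_zero]
      simpa using hx hr
    exact hle h

lemma quotient_smul_top_exact (I : Ideal R) {f : A →ₗ[R] B} {g : B →ₗ[R] C} (hfg : Exact f g)
    (hg : Surjective g) :
    Exact ((I • ⊤ : Submodule R A).mapQ (I • ⊤) f (Submodule.smul_top_le_comap_smul_top I f))
      ((I • ⊤ : Submodule R B).mapQ (I • ⊤) g (Submodule.smul_top_le_comap_smul_top I g)) := by
  intro b
  obtain ⟨b, rfl⟩ := Submodule.mkQ_surjective _ b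
  rw [Submodule.mkQ_apply, Submodule.mapQ_apply, Submodule.Quotient.mk_eq_zero]
  constructor
  · intro h
    have hmap : (I • ⊤ : Submodule R C) = (I • ⊤ : Submodule R B).map g := by
      rw [Submodule.map_smul'', Submodule.map_top, LinearMap.range_eq_top.2 hg]
    rw [hmap] at h
    obtain ⟨b', hb', h⟩ := h
    obtain ⟨a, ha⟩ := (hfg (b - b')).1 (by rw [map_sub, h, sub_self])
    refine ⟨Submodule.Quotient.mk a, ?_⟩
    rw [Submodule.mapQ_apply, ha, Submodule.Quotient.eq]
    simpa using hb'
  · rintro ⟨a, ha⟩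
    obtain ⟨a, rfl⟩ := Submodule.mkQ_surjective _ a
    rw [Submodule.mkQ_apply, Submodule.mapQ_apply, Submodule.Quotient.eq] at ha
    have := Submodule.smul_top_le_comap_smul_top I g ha
    rwa [Submodule.mem_comap, map_sub, (hfg (f a)).2 ⟨a, rfl⟩, zero_sub, neg_mem_iff] at this

lemma mapQ_ofList_injective {xs : List R} {f : A →ₗ[R] B} {g : B →ₗ[R] C} (hf : Injective f)
    (hfg : Exact f g) (hg : Surjective g) (hxC : RingTheory.Sequence.IsWeaklyRegular C xs) :
    Injective ((Ideal.ofList xs • ⊤ : Submodule R A).mapQ (Ideal.ofList xs • ⊤) f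
      (Submodule.smul_top_le_comap_smul_top _ f)) := by
  rw [injective_iff_map_eq_zero]
  intro a ha
  obtain ⟨a, rfl⟩ := Submodule.mkQ_surjective _ a
  rw [Submodule.mkQ_apply, Submodule.mapQ_apply, Submodule.Quotient.mk_eq_zero] at ha
  rw [Submodule.mkQ_apply, Submodule.Quotient.mk_eq_zero]
  exact RingTheory.Sequence.mem_ofList_smul_top_of_exact hf hfg hg hxC ha

lemma mapQ_smul_top_surjective (I : Ideal R) {g : B →ₗ[R] C} (hg : Surjective g) :
    Surjective ((I • ⊤ : Submodule R B).mapQ (I • ⊤) g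
      (Submodule.smul_top_le_comap_smul_top I g)) := fun c => by
  obtain ⟨c, rfl⟩ := Submodule.mkQ_surjective _ c
  obtain ⟨b, rfl⟩ := hg c
  exact ⟨Submodule.Quotient.mk b, rfl⟩

/-- The base change of a linear map between finite free modules is multiplication by the base
change of its matrix. -/
lemma piScalarRight_baseChange {m n : Type*} [Fintype m] [DecidableEq m] [Fintype n]
    [DecidableEq n] (f : (n → R) →ₗ[R] (m → R)) (x : S ⊗[R] (n → R)) :
    TensorProduct.piScalarRight R S S m (f.baseChange S x) =
      ((LinearMap.toMatrix' f).map (algebraMap R S)).mulVec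
        (TensorProduct.piScalarRight R S S n x) := by
  induction x with
  | zero => simp
  | tmul s v =>
    ext i
    rw [LinearMap.baseChange_tmul, TensorProduct.piScalarRight_apply,
      TensorProduct.piScalarRight_apply, TensorProduct.piScalarRightHom_tmul,
      TensorProduct.piScalarRightHom_tmul, ← LinearMap.toMatrix'_mulVec]
    simp only [Matrix.mulVec, dotProduct, Matrix.map_apply, Algebra.smul_def, map_sum, map_mul,
      Finset.sum_mul, mul_assoc]
  | add x y hx hy => rw [map_add, map_add, hx, hy, map_add, Matrix.mulVec_add]

end BaseChange

section TorQuotient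

variable {R : Type u} [CommRing R] {S : Type u} [CommRing S] [Algebra R S]
variable {A B C : Type*} [AddCommGroup A] [AddCommGroup B] [AddCommGroup C]
  [Module R A] [Module R B] [Module R C] [Module.Flat R B] {xs : List R}

lemma IsWeaklyRegular.of_flat_module (hx : IsWeaklyRegular R xs) : IsWeaklyRegular B xs :=
  ((TensorProduct.rid R B).isWeaklyRegular_congr xs).1 (hx.isWeaklyRegular_lTensor (M₂ := B))

lemma torSuccVanishes_quotient_of_flat (hx : IsWeaklyRegular R xs) (hxS : IsWeaklyRegular S xs)
    (j : ℕ) : TorSuccVanishes R (B ⧸ (Ideal.ofList xs • ⊤ : Submodule R B)) j S :=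
  TorSuccVanishes.quotient_ofList (fun j => .of_flat B j S) (IsWeaklyRegular.of_flat_module hx)
    (hxS.isWeaklyRegular_lTensor (M₂ := B)) j

lemma torSuccVanishes_quotient_succ_iff {f : A →ₗ[R] B} {g : B →ₗ[R] C} (hf : Injective f)
    (hfg : Exact f g) (hg : Surjective g) (hx : IsWeaklyRegular R xs) (hxS : IsWeaklyRegular S xs)
    (hxC : IsWeaklyRegular C xs) (j : ℕ) :
    TorSuccVanishes R (C ⧸ (Ideal.ofList xs • ⊤ : Submodule R C)) (j + 1) S ↔
      TorSuccVanishes R (A ⧸ (Ideal.ofList xs • ⊤ : Submodule R A)) j S :=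
  torSuccVanishes_succ_iff (mapQ_ofList_injective hf hfg hg hxC)
    (quotient_smul_top_exact _ hfg hg) (mapQ_smul_top_surjective _ hg)
    (torSuccVanishes_quotient_of_flat hx hxS) j

lemma torSuccVanishes_quotient_zero_iff {f : A →ₗ[R] B} {g : B →ₗ[R] C} (hf : Injective f)
    (hfg : Exact f g) (hg : Surjective g) (hx : IsWeaklyRegular R xs) (hxS : IsWeaklyRegular S xs)
    (hxC : IsWeaklyRegular C xs) :
    TorSuccVanishes R (C ⧸ (Ideal.ofList xs • ⊤ : Submodule R C)) 0 S ↔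
      ∀ e : S ⊗[R] A, f.baseChange S e ∈
          (Ideal.ofList (xs.map (algebraMap R S)) • ⊤ : Submodule S (S ⊗[R] B)) →
        e ∈ (Ideal.ofList (xs.map (algebraMap R S)) • ⊤ : Submodule S (S ⊗[R] A)) := by
  rw [torSuccVanishes_zero_iff (mapQ_ofList_injective hf hfg hg hxC)
    (quotient_smul_top_exact _ hfg hg) (mapQ_smul_top_surjective _ hg)
    (torSuccVanishes_quotient_of_flat hx hxS 0), ← LinearMap.lTensor_inj_iff_rTensor_inj,
    injective_iff_map_eq_zero, (LinearMap.lTensor_surjective S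
      (Submodule.mkQ_surjective (Ideal.ofList xs • ⊤ : Submodule R A))).forall]
  refine forall_congr' fun e => ?_
  rw [baseChange_mkQ_eq_zero_iff, ← Ideal.map_ofList, ← baseChange_mkQ_eq_zero_iff (A := B)]
  refine imp_congr (iff_of_eq (congrArg (· = 0) ?_)) Iff.rfl
  rw [← LinearMap.comp_apply, ← LinearMap.lTensor_comp, Submodule.mapQ_mkQ, LinearMap.lTensor_comp]
  rfl

end TorQuotient

section MinimalCover

variable {R : Type*} [CommRing R]

lemma Pi.mem_ideal_smul_top_iff {n : Type*} [Fintype n] (I : Ideal R) (v : n → R) :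
    v ∈ (I • ⊤ : Submodule R (n → R)) ↔ ∀ i, v i ∈ I := by
  classical
  constructor
  · intro hv i
    refine Submodule.smul_induction_on hv (fun r hr w _ => ?_) fun a b ha hb => add_mem ha hb
    exact I.mul_mem_right _ hr
  · intro h
    rw [pi_eq_sum_univ v]
    exact Submodule.sum_mem _ fun i _ => Submodule.smul_mem_smul (h i) trivial

/-- A finite module over a local ring is covered by a finite free module such that the
coefficients of all relations lie in the maximal ideal. -/
lemma IsLocalRing.exists_minimal_cover [IsLocalRing R] (M : Type*) [AddCommGroup M] [Module R M]
    [Module.Finite R M] : ∃ (b : ℕ) (f : (Fin b → R) →ₗ[R] M), Surjective f ∧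
      ∀ v, f v = 0 → v ∈ (maximalIdeal R • ⊤ : Submodule R (Fin b → R)) := by
  let k := ResidueField R
  let B := Module.finBasis k (k ⊗[R] M)
  have hsurj : Surjective (TensorProduct.mk R k M 1) :=
    TensorProduct.mk_surjective R M k IsLocalRing.residue_surjective
  choose w hw using fun i => hsurj (B i)
  refine ⟨_, Fintype.linearCombination R w, ?_, fun v hv => ?_⟩
  · rw [← LinearMap.range_eq_top, Fintype.range_linearCombination]
    exact IsLocalRing.span_eq_top_of_tmul_eq_basis w B hw
  · rw [Pi.mem_ideal_smul_top_iff]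
    intro i
    rw [Fintype.linearCombination_apply] at hv
    have h := congrArg (TensorProduct.mk R k M 1) hv
    rw [map_sum, map_zero] at h
    simp only [map_smul, hw] at h
    have h' : ∑ i, residue R (v i) • B i = 0 := by
      rw [← h]
      exact Finset.sum_congr rfl fun i _ => algebraMap_smul k (v i) (B i)
    rw [← residue_eq_zero_iff]
    exact Fintype.linearIndependent_iff.1 B.linearIndependent _ h' i

end MinimalCover

section FiniteProjectiveDimension

variable {R : Type u} [CommRing R] [IsNoetherianRing R] [IsLocalRing R]

lemma exists_socle_of_supportDim_quotient_le_zero {I : Ideal R} (hI : I ≠ ⊤)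
    (hdim : Module.supportDim R (R ⧸ I) ≤ 0) :
    ∃ t, t ∉ I ∧ ∀ r ∈ maximalIdeal R, r * t ∈ I := by
  have : Nontrivial (R ⧸ I) := Ideal.Quotient.nontrivial_iff.2 hI
  obtain ⟨P, hP⟩ := associatedPrimes.nonempty R (R ⧸ I)
  have hPs : (⟨P, hP.isPrime⟩ : PrimeSpectrum R) ∈ Module.support R (R ⧸ I) := by
    rw [Module.mem_support_iff_of_finite, ← Submodule.annihilator_top]
    exact IsAssociatedPrime.annihilator_le hP
  have h0 : Order.coheight (⟨P, hP.isPrime⟩ : PrimeSpectrum R) = 0 := by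
    have := (coheight_le_supportDim hPs).trans hdim
    exact le_antisymm (WithBot.coe_le_coe.1 this) zero_le
  have hmax := Order.coheight_eq_zero.1 h0
  have hPm : maximalIdeal R ≤ P := hmax (b := closedPoint R) (le_maximalIdeal hP.isPrime.ne_top)
  obtain ⟨hPp, t, ht⟩ := isAssociatedPrime_iff.1 (AssociatedPrimes.mem_iff.1 hP)
  obtain ⟨t, rfl⟩ := Ideal.Quotient.mk_surjective t
  have hPt : ∀ r, r ∈ P ↔ r * t ∈ I := fun r => by
    rw [ht, Submodule.mem_colon_singleton, Submodule.mem_bot, ← Ideal.Quotient.eq_zero_iff_mem]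
    rfl
  refine ⟨t, fun h => hPp.ne_top ?_, fun r hr => (hPt r).1 (hPm hr)⟩
  rw [Ideal.eq_top_iff_one, hPt, one_mul]
  exact h

/-- A module of finite projective dimension on which a sequence `zs` with `dim R / (zs) ≤ 0` is
regular is free. -/
theorem free_of_hasProjectiveDimensionLT {zs : List R} (hz : ∀ z ∈ zs, z ∈ maximalIdeal R)
    (hzR : IsWeaklyRegular R zs)
    (hdim : Module.supportDim R (R ⧸ Ideal.ofList zs) ≤ 0) (n : ℕ)
    (Z : Type u) [AddCommGroup Z] [Module R Z] [Module.Finite R Z] (hZ : IsWeaklyRegular Z zs)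
    (hpd : HasProjectiveDimensionLT (ModuleCat.of R Z) (n + 1)) : Module.Free R Z := by
  have hne : Ideal.ofList zs ≠ ⊤ := fun h =>
    (maximalIdeal.isMaximal R).ne_top (top_le_iff.1 (h ▸ Ideal.span_le.2 hz))
  obtain ⟨t, ht, htm⟩ := exists_socle_of_supportDim_quotient_le_zero hne hdim
  induction n generalizing Z with
  | zero =>
    have : Projective (ModuleCat.of R Z) := projective_iff_hasProjectiveDimensionLT_one.2 hpd
    have : Module.Projective R Z := (IsProjective.iff_projective Z).2 this
    exact Module.free_of_flat_of_isLocalRing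
  | succ n ih =>
    obtain ⟨b, f, hf, hker⟩ := IsLocalRing.exists_minimal_cover (R := R) Z
    have hS := LinearMap.shortExact_shortComplexKer hf
    have hpd' : HasProjectiveDimensionLT (ModuleCat.of R (LinearMap.ker f)) (n + 1) :=
      (hS.hasProjectiveDimensionLT_X₃_iff n
        ((IsProjective.iff_projective (Fin b → R)).1 inferInstance)).1 hpd
    have hinj := Submodule.injective_subtype (LinearMap.ker f)
    have hex := LinearMap.exact_subtype_ker_map f
    have hreg : IsWeaklyRegular (LinearMap.ker f) zs :=
      IsWeaklyRegular.of_exact_left hinj hex hf (IsWeaklyRegular.of_flat_module hzR) hZ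
    have hfree := ih (LinearMap.ker f) hreg hpd'
    have hbot : LinearMap.ker f = ⊥ := by
      by_contra hnb
      have : Nontrivial (LinearMap.ker f) := Submodule.nontrivial_iff_ne_bot.2 hnb
      let B := Module.Free.chooseBasis R (LinearMap.ker f)
      obtain ⟨i⟩ := B.index_nonempty
      have hmem : t • B i ∈ (Ideal.ofList zs • ⊤ : Submodule R (LinearMap.ker f)) := by
        refine mem_ofList_smul_top_of_exact hinj hex hf hZ ?_
        rw [Pi.mem_ideal_smul_top_iff]
        intro j
        have := (Pi.mem_ideal_smul_top_iff _ _).1 (hker _ (B i).2) j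
        simpa [mul_comm] using htm _ this
      have hco : ∀ x ∈ (Ideal.ofList zs • ⊤ : Submodule R (LinearMap.ker f)),
          B.repr x i ∈ Ideal.ofList zs := fun x hx => by
        refine Submodule.smul_induction_on hx (fun r hr w _ => ?_) fun x y hx hy => ?_
        · simpa using Ideal.mul_mem_right _ _ hr
        · simpa using add_mem hx hy
      exact ht (by simpa using hco _ hmem)
    exact Module.Free.of_equiv (LinearEquiv.ofBijective f ⟨LinearMap.ker_eq_bot.1 hbot, hf⟩)

end FiniteProjectiveDimension

section Rigidity

variable {R : Type u} [CommRing R] [IsLocalRing R]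
  {S : Type u} [CommRing S] [IsNoetherianRing S] [IsLocalRing S] [Algebra R S]

/-- Let `ι : A → B` be a linear map to a finite free module that stays injective after base change
to `S` and reduction modulo `xs`, a sequence which `z` extends to an `S`-regular one. If the
maximal ideal of `R` is mapped into an ideal generated by a system of parameters `ys` of `S`,
then every minimal cover of `A` becomes injective after base change to `S`. -/
lemma baseChange_comp_injective {A B : Type u} [AddCommGroup A] [AddCommGroup B] [Module R A]
    [Module R B] [Module.Finite R A] [Module.Finite R B] [Module.Free R B] (ι : A →ₗ[R] B)
    {xs : List S} {z : S} (hxs : ∀ x ∈ xs, x ∈ maximalIdeal S) (hz : z ∈ maximalIdeal S)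
    (hreg : IsWeaklyRegular S (xs ++ [z]))
    (hι : ∀ e : S ⊗[R] A, ι.baseChange S e ∈ (Ideal.ofList xs • ⊤ : Submodule S (S ⊗[R] B)) →
      e ∈ (Ideal.ofList xs • ⊤ : Submodule S (S ⊗[R] A)))
    {ys : List S} (hys : ∀ y ∈ ys, y ∈ maximalIdeal S) (hlen : ys.length = xs.length + 1)
    (hdim : Module.supportDim S (S ⧸ Ideal.ofList ys) ≤ 0)
    (hmy : (maximalIdeal R).map (algebraMap R S) ≤ Ideal.ofList ys)
    {b : ℕ} {f : (Fin b → R) →ₗ[R] A} (hf : Surjective f)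
    (hker : ∀ v, f v = 0 → v ∈ (maximalIdeal R • ⊤ : Submodule R (Fin b → R))) :
    Injective ((ι ∘ₗ f).baseChange S) := by
  have hregB : IsWeaklyRegular (S ⊗[R] B) (xs ++ [z]) := IsWeaklyRegular.of_flat_module hreg
  rw [isWeaklyRegular_append_iff, isWeaklyRegular_singleton_iff] at hregB
  obtain ⟨hinj, hregA⟩ := injective_of_injective_mod_of_isWeaklyRegular hxs (ι.baseChange S)
    hregB.1 hι
  have hregA' : IsWeaklyRegular (S ⊗[R] A) (xs ++ [z]) := by
    rw [isWeaklyRegular_append_iff, isWeaklyRegular_singleton_iff]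
    refine ⟨hregA, hregB.2.of_injective ((Ideal.ofList xs • ⊤ : Submodule S (S ⊗[R] A)).mapQ
      (Ideal.ofList xs • ⊤) (ι.baseChange S) (Submodule.smul_top_le_comap_smul_top _ _)) ?_⟩
    rw [injective_iff_map_eq_zero]
    intro a ha
    obtain ⟨a, rfl⟩ := Submodule.mkQ_surjective _ a
    rw [Submodule.mkQ_apply, Submodule.mapQ_apply, Submodule.Quotient.mk_eq_zero] at ha
    rw [Submodule.mkQ_apply, Submodule.Quotient.mk_eq_zero]
    exact hι a ha
  have hyA : IsWeaklyRegular (S ⊗[R] A) ys := by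
    refine isWeaklyRegular_of_supportDim_quotient_le_zero (zs := xs ++ [z]) ?_ hregA' hys
      (by simpa using hlen) (le_trans ?_ hdim)
    · simp only [List.mem_append, List.mem_singleton]
      rintro w (hw | rfl)
      exacts [hxs w hw, hz]
    · refine Order.krullDim_le_of_strictMono (fun P => ⟨P.1, ?_⟩) fun _ _ h => h
      have hP := P.2
      rw [Module.mem_support_iff_of_finite] at hP ⊢
      rw [Ideal.annihilator_quotient]
      refine le_trans (fun r hr => Module.mem_annihilator.2 fun e => ?_) hP
      obtain ⟨e, rfl⟩ := Submodule.mkQ_surjective _ e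
      rw [← map_smul, Submodule.mkQ_apply, Submodule.Quotient.mk_eq_zero]
      exact Submodule.smul_mem_smul hr Submodule.mem_top
  have hfs : Surjective (f.baseChange S) := LinearMap.lTensor_surjective S hf
  have hK : LinearMap.ker (f.baseChange S) = ⊥ := by
    have hKy : ∀ e, f.baseChange S e = 0 →
        e ∈ (Ideal.ofList ys • ⊤ : Submodule S (S ⊗[R] (Fin b → R))) := by
      intro e he
      obtain ⟨w, rfl⟩ := (lTensor_exact S (LinearMap.exact_subtype_ker_map f) hf e).1 he
      clear he
      induction w with
      | zero => simp
      | tmul s v =>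
        rw [LinearMap.lTensor_tmul]
        exact Submodule.smul_mono_left hmy (tmul_mem_map_smul_top (hker _ v.2) s)
      | add x y hx hy => rw [map_add]; exact add_mem hx hy
    refine Submodule.eq_bot_of_le_smul_of_le_jacobson_bot (Ideal.ofList ys) _
      (IsNoetherian.noetherian _) ?_ ?_
    · intro e he
      have := mem_ofList_smul_top_of_exact (a := (⟨e, he⟩ : LinearMap.ker (f.baseChange S)))
        (Submodule.injective_subtype _) (LinearMap.exact_subtype_ker_map _) hfs hyA (hKy e he)
      exact (Submodule.mem_smul_top_iff _ _ _).1 this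
    · rw [IsLocalRing.jacobson_eq_maximalIdeal _ bot_ne_top]
      exact Ideal.span_le.2 hys
  rw [LinearMap.baseChange_comp]
  exact hinj.comp (LinearMap.ker_eq_bot.1 hK)

end Rigidity

section FiniteLength

variable {R : Type u} [CommRing R] [IsLocalRing R]

lemma IsFiniteLength.support_subset {M : Type*} [AddCommGroup M] [Module R M]
    (h : IsFiniteLength R M) : Module.support R M ⊆ {closedPoint R} := by
  induction h with
  | of_subsingleton => simp [Module.support_eq_empty_iff.2 inferInstance]
  | @of_simple_quotient M _ _ N hN _ ih =>
    rw [Module.support_of_exact (LinearMap.exact_subtype_mkQ N) (Submodule.injective_subtype N)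
      (Submodule.mkQ_surjective N)]
    refine Set.union_subset ih fun P hP => ?_
    have hmax : (Module.annihilator R (M ⧸ N)).IsMaximal := IsSimpleModule.annihilator_isMaximal
    have hle := Module.annihilator_le_of_mem_support hP
    have heq := hmax.eq_of_le P.isPrime.ne_top hle
    refine PrimeSpectrum.ext ?_
    rw [← heq]
    exact IsLocalRing.eq_maximalIdeal hmax

lemma IsFiniteLength.supportDim_le_zero {M : Type*} [AddCommGroup M] [Module R M]
    (h : IsFiniteLength R M) : Module.supportDim R M ≤ 0 := by
  have : Subsingleton (Module.support R M) :=
    Set.subsingleton_coe _ |>.2 (Set.subsingleton_singleton.anti h.support_subset)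
  exact Order.krullDim_nonpos_of_subsingleton

variable [IsNoetherianRing R]

lemma exists_maximalIdeal_pow_le_of_supportDim_le_zero {I : Ideal R}
    (hdim : Module.supportDim R (R ⧸ I) ≤ 0) : ∃ k, maximalIdeal R ^ k ≤ I := by
  by_cases hI : I = ⊤
  · exact ⟨0, by simp [hI]⟩
  refine Ideal.exists_pow_le_of_le_radical_of_fg ?_ (IsNoetherian.noetherian _)
  rw [Ideal.radical_eq_sInf]
  refine le_sInf fun P ⟨hIP, hP⟩ => ?_
  have hPs : (⟨P, hP⟩ : PrimeSpectrum R) ∈ Module.support R (R ⧸ I) := by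
    rw [Module.mem_support_iff_of_finite, Ideal.annihilator_quotient]
    exact hIP
  have h0 : Order.coheight (⟨P, hP⟩ : PrimeSpectrum R) = 0 :=
    le_antisymm (WithBot.coe_le_coe.1 ((coheight_le_supportDim hPs).trans hdim)) zero_le
  have hmax := Order.coheight_eq_zero.1 h0
  exact hmax (b := closedPoint R) (le_maximalIdeal hP.ne_top)

lemma isFiniteLength_quotient_of_supportDim_le_zero {R : Type*} [CommRing R] [IsNoetherianRing R]
    {I : Ideal R}
    (hdim : Module.supportDim R (R ⧸ I) ≤ 0) : IsFiniteLength R (R ⧸ I) := by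
  rw [isFiniteLength_iff_isNoetherian_isArtinian]
  refine ⟨inferInstance, ?_⟩
  have : Ring.KrullDimLE 0 (R ⧸ I) := by
    rw [Ring.krullDimLE_iff, ← Module.supportDim_quotient_eq_ringKrullDim]
    exact hdim
  have : IsArtinianRing (R ⧸ I) := isArtinianRing_iff_krullDimLE_zero.2 this
  exact isArtinian_of_surjective_algebraMap (R := R ⧸ I) Ideal.Quotient.mk_surjective

end FiniteLength

namespace FrobeniusRigidity

section CohenMacaulay

variable {R : Type u} [CommRing R] [IsLocalRing R]

lemma exists_isRegular_of_depth_eq {M : Type u} [AddCommGroup M] [Module R M] [Nontrivial M]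
    {n : ℕ} (h : depth R M = n) : ∃ zs : List R, zs.length = n ∧
      (∀ z ∈ zs, z ∈ maximalIdeal R) ∧ IsRegular M zs := by
  have hle : ∀ zs : List R, (∀ z ∈ zs, z ∈ maximalIdeal R) ∧ IsRegular M zs → zs.length ≤ n := by
    intro zs hzs
    have := le_iSup₂_of_le (f := fun (rs : List R) (_ : rs ∈ {rs : List R |
      (∀ r ∈ rs, r ∈ maximalIdeal R) ∧ IsRegular M rs}) => (rs.length : ℕ∞)) zs hzs le_rfl
    exact_mod_cast this.trans_eq h
  by_contra! hcon
  have hlt : ∀ zs : List R, (∀ z ∈ zs, z ∈ maximalIdeal R) ∧ IsRegular M zs →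
      zs.length + 1 ≤ n := fun zs hzs =>
    lt_of_le_of_ne (hle zs hzs) fun hn => hcon zs hn hzs.1 hzs.2
  have h0 := hlt [] ⟨by simp, .nil R M⟩
  have : depth R M ≤ ((n - 1 : ℕ) : ℕ∞) := iSup₂_le fun zs hzs => by
    have := hlt zs hzs
    exact_mod_cast (by omega : zs.length ≤ n - 1)
  rw [h] at this
  have : n ≤ n - 1 := by exact_mod_cast this
  simp at h0
  omega

/-- Over a Cohen–Macaulay module of dimension `n` there is a regular sequence of length `n`. -/
lemma IsCohenMacaulayModule.exists_isRegular {M : Type u} [AddCommGroup M] [Module R M]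
    [Nontrivial M] (hM : IsCohenMacaulayModule R M) {n : ℕ}
    (hn : Module.supportDim R M = (n : ℕ∞)) : ∃ zs : List R, zs.length = n ∧
      (∀ z ∈ zs, z ∈ maximalIdeal R) ∧ IsRegular M zs := by
  rcases hM with h | h
  · exact (not_subsingleton M h).elim
  · exact exists_isRegular_of_depth_eq (WithBot.coe_injective (h.trans hn))

variable [IsNoetherianRing R]

/-- Every system of parameters of a Cohen–Macaulay module is a regular sequence. -/
lemma IsSystemOfParameters.isWeaklyRegular {M : Type u} [AddCommGroup M] [Module R M]
    [Module.Finite R M] (hM : IsCohenMacaulayModule R M) {xs : List R}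
    (hx : IsSystemOfParameters M xs) : IsWeaklyRegular M xs := by
  have hnt : Nontrivial M := by
    rw [← Module.supportDim_ne_bot_iff_nontrivial R, ← hx.length_eq]
    exact WithBot.coe_ne_bot
  obtain ⟨zs, hlen, hz, hzs⟩ := hM.exists_isRegular hx.length_eq.symm
  exact isWeaklyRegular_of_supportDim_quotient_le_zero hz hzs.1 hx.mem_maximalIdeal hlen.symm
    hx.finite_length.supportDim_le_zero

lemma exists_isRegular_quotient_ofList {M : Type u} [AddCommGroup M] [Module R M] [Nontrivial M]
    [Module.Finite R M] {xs : List R} (hx : ∀ x ∈ xs, x ∈ maximalIdeal R)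
    (hxs : IsWeaklyRegular M xs) {zs : List R} (hz : ∀ z ∈ zs, z ∈ maximalIdeal R)
    (hzs : IsRegular M zs) {n : ℕ} (hn : zs.length = xs.length + n) :
    ∃ rs : List R, rs.length = n ∧ (∀ r ∈ rs, r ∈ maximalIdeal R) ∧
      IsRegular (M ⧸ (Ideal.ofList xs • ⊤ : Submodule R M)) rs := by
  induction xs generalizing M zs with
  | nil =>
    refine ⟨zs, by simpa using hn, hz, ?_⟩
    exact ((Submodule.quotEquivOfEqBot (Ideal.ofList ([] : List R) • ⊤ : Submodule R M)
      (by simp [Ideal.ofList_nil])).isRegular_congr zs).2 hzs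
  | cons x xs ih =>
    simp only [List.mem_cons, forall_eq_or_imp] at hx
    rw [isWeaklyRegular_cons_iff] at hxs
    obtain ⟨rs, hlen, hr, hrs⟩ := exists_isRegular_quotSMulTop hx.1 hxs.1 hz hzs
      (n := xs.length + n) (by rw [hn, List.length_cons]; omega)
    have := nontrivial_quotSMulTop_of_mem_maximalIdeal M hx.1
    obtain ⟨ts, h1, h2, h3⟩ := ih hx.2 hxs.2 hr hrs hlen
    exact ⟨ts, h1, h2,
      ((Submodule.quotOfListConsSMulTopEquivQuotSMulTopInner M x xs).isRegular_congr ts).2 h3⟩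

lemma supportDim_quotient_le_zero_of_isRegular {zs : List R}
    (hz : ∀ z ∈ zs, z ∈ maximalIdeal R) (hzs : IsWeaklyRegular R zs)
    (hdim : ringKrullDim R = (zs.length : ℕ∞)) :
    Module.supportDim R (R ⧸ Ideal.ofList zs) ≤ 0 := by
  have h := ringKrullDim_add_length_eq_ringKrullDim_of_isRegular zs
    ((isRegular_iff_isWeaklyRegular_of_subset_maximalIdeal hz).2 hzs)
  rw [Module.supportDim_quotient_eq_ringKrullDim]
  rw [← ENat.WithBot.add_le_add_natCast_right_iff (c := zs.length), h, hdim, zero_add]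
  exact le_rfl

end CohenMacaulay

section Twist

variable (R : Type u) [CommRing R] (p : ℕ) [Fact p.Prime] [CharP R p] (n : ℕ)

/-- The ring `R` as an algebra over itself through the `n`-th iterate of the Frobenius. -/
def FrobeniusTwist (R : Type u) (_p _n : ℕ) : Type u := R

instance : CommRing (FrobeniusTwist R p n) := inferInstanceAs (CommRing R)

instance [IsNoetherianRing R] : IsNoetherianRing (FrobeniusTwist R p n) :=
  inferInstanceAs (IsNoetherianRing R)

instance [IsLocalRing R] : IsLocalRing (FrobeniusTwist R p n) :=
  inferInstanceAs (IsLocalRing R)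

instance : Algebra R (FrobeniusTwist R p n) := (iterateFrobenius R p n).toAlgebra

variable {R p n}

lemma isZero_frobeniusTor_succ_iff (N : Type u) [AddCommGroup N] [Module R N] (j : ℕ) :
    Limits.IsZero (frobeniusTor R p (j + 1) n N) ↔
      TorSuccVanishes R N j (FrobeniusTwist R p n) :=
  isZero_tor'_succ_iff (ModuleCat.of R N) (frobeniusModule R p n) j

lemma isWeaklyRegular_map_frobeniusTwist {xs : List R} (hx : IsWeaklyRegular R xs) :
    IsWeaklyRegular (FrobeniusTwist R p n) (xs.map (algebraMap R (FrobeniusTwist R p n))) :=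
  hx.map_pow (p ^ n)

lemma isWeaklyRegular_frobeniusTwist {xs : List R} (hx : IsWeaklyRegular R xs) :
    IsWeaklyRegular (FrobeniusTwist R p n) xs :=
  (isWeaklyRegular_map_algebraMap_iff _ _ xs).1 (isWeaklyRegular_map_frobeniusTwist hx)

end Twist

section Kappa

variable {R : Type u} [CommRing R] [IsNoetherianRing R] [IsLocalRing R]
  (p : ℕ) [Fact p.Prime] [CharP R p]

/-- For `n ≥ κ(R)` over a Cohen–Macaulay ring, the `p ^ n`-th Frobenius power of the maximal ideal
is contained in an ideal generated by a system of parameters. -/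
lemma exists_systemOfParameters_of_kappa_le (hR : IsCohenMacaulayModule R R) {d : ℕ}
    (hd : ringKrullDim R = (d : ℕ∞)) {n : ℕ} (hn : kappa R p ≤ n) :
    ∃ ys : List R, IsSystemOfParameters R ys ∧
      (maximalIdeal R).map (iterateFrobenius R p n) ≤ Ideal.ofList ys := by
  have hdR : Module.supportDim R R = (d : ℕ∞) := by
    rw [Module.supportDim_self_eq_ringKrullDim, hd]
  have hmono : ∀ {s t : ℕ} {I : Ideal R}, s ≤ t →
      (maximalIdeal R).map (iterateFrobenius R p s) ≤ I →
      (maximalIdeal R).map (iterateFrobenius R p t) ≤ I := by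
    intro s t I hst hs
    rw [Ideal.map_le_iff_le_comap] at hs ⊢
    intro r hr
    have := hs hr
    rw [Ideal.mem_comap, iterateFrobenius_def] at this ⊢
    obtain ⟨k, rfl⟩ := Nat.exists_eq_add_of_le hst
    rw [pow_add, pow_mul]
    exact Ideal.pow_mem_of_mem _ this _ (pow_pos (Fact.out : p.Prime).pos k)
  have hne : {t : ℕ | ∃ xs : List R, IsSystemOfParameters R xs ∧
      (maximalIdeal R).map (iterateFrobenius R p t) ≤ Ideal.ofList xs}.Nonempty := by
    obtain ⟨zs, hlen, hz, hzs⟩ := hR.exists_isRegular hdR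
    have hdim := supportDim_quotient_le_zero_of_isRegular hz hzs.1 (by rw [hlen, hd])
    obtain ⟨k, hk⟩ := exists_maximalIdeal_pow_le_of_supportDim_le_zero hdim
    refine ⟨k, zs, ⟨hz, by rw [hlen, hdR], ?_⟩, ?_⟩
    · have h := isFiniteLength_quotient_of_supportDim_le_zero hdim
      have e : Ideal.ofList zs • (⊤ : Submodule R R) = Ideal.ofList zs := by simp
      exact (Submodule.quotEquivOfEq _ _ e).symm.isFiniteLength h
    · rw [Ideal.map_le_iff_le_comap]
      intro r hr
      rw [Ideal.mem_comap, iterateFrobenius_def]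
      refine hk (Ideal.pow_le_pow_right ?_ (Ideal.pow_mem_pow hr _))
      exact (Nat.lt_pow_self (Fact.out : p.Prime).one_lt).le
  obtain ⟨ys, hys, hle⟩ := Nat.sInf_mem hne
  exact ⟨ys, hys, hmono hn hle⟩

end Kappa

end FrobeniusRigidity

lemma LinearEquiv.apply_mem_smul_top_iff {R A B : Type*} [CommRing R] [AddCommGroup A]
    [AddCommGroup B] [Module R A] [Module R B] (e : A ≃ₗ[R] B) (I : Ideal R) (a : A) :
    e a ∈ (I • ⊤ : Submodule R B) ↔ a ∈ (I • ⊤ : Submodule R A) := by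
  refine ⟨fun h => ?_, fun h => Submodule.smul_top_le_comap_smul_top I e.toLinearMap h⟩
  simpa using Submodule.smul_top_le_comap_smul_top I e.symm.toLinearMap h

/-- If a matrix is injective modulo an ideal `I` of a Noetherian ring, its maximal minors generate
an ideal containing an element that is regular modulo `I`. -/
lemma Matrix.exists_mem_span_det_submatrix_isSMulRegular {R : Type*} [CommRing R]
    [IsNoetherianRing R] {b c : ℕ} {A : Matrix (Fin c) (Fin b) R} {I : Ideal R}
    (hA : ∀ v, (∀ i, A.mulVec v i ∈ I) → ∀ j, v j ∈ I) :
    ∃ y ∈ Ideal.span (Set.range fun f : Fin b → Fin c => (A.submatrix f id).det),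
      IsSMulRegular (R ⧸ I) y := by
  set J := Ideal.span (Set.range fun f : Fin b → Fin c => (A.submatrix f id).det) with hJ
  have hinj : Injective (A.map (Ideal.Quotient.mk I)).mulVec := by
    rw [← Matrix.coe_mulVecLin, injective_iff_map_eq_zero]
    intro v hv
    obtain ⟨v, rfl⟩ : ∃ w : Fin b → R, v = Ideal.Quotient.mk I ∘ w := by
      choose w hw using fun j => Ideal.Quotient.mk_surjective (v j)
      exact ⟨w, funext fun j => (hw j).symm⟩
    refine funext fun j => Ideal.Quotient.eq_zero_iff_mem.2 (hA v (fun i => ?_) j)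
    rw [← Ideal.Quotient.eq_zero_iff_mem, RingHom.map_mulVec]
    exact congrFun hv i
  have hsub : Subsingleton ((R ⧸ J) →ₗ[R] (R ⧸ I)) := by
    refine subsingleton_of_forall_eq 0 fun h => ?_
    have h1 : h 1 = 0 := by
      refine Matrix.eq_zero_of_forall_mul_det_submatrix_eq_zero hinj fun f => ?_
      have hdet : ((A.map (Ideal.Quotient.mk I)).submatrix f id).det =
          Ideal.Quotient.mk I (A.submatrix f id).det := by
        rw [RingHom.map_det]; rfl
      have hmem : (A.submatrix f id).det ∈ J := Ideal.subset_span ⟨f, rfl⟩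
      calc h 1 * ((A.map (Ideal.Quotient.mk I)).submatrix f id).det
          = (A.submatrix f id).det • h 1 := by rw [hdet, mul_comm]; rfl
        _ = h ((A.submatrix f id).det • 1) := (map_smul h _ _).symm
        _ = h (Ideal.Quotient.mk J (A.submatrix f id).det) := by
          rw [Algebra.smul_def, mul_one]; rfl
        _ = 0 := by rw [Ideal.Quotient.eq_zero_iff_mem.2 hmem, map_zero]
    ext
    simpa using h1
  obtain ⟨y, hy, hreg⟩ := IsSMulRegular.subsingleton_linearMap_iff.1 hsub
  rw [Ideal.annihilator_quotient] at hy
  exact ⟨y, hy, hreg⟩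

namespace FrobeniusRigidity

variable {R : Type u} [CommRing R] [IsNoetherianRing R] {p : ℕ} [Fact p.Prime] [CharP R p]

/-- A matrix injective modulo a regular sequence stays so after applying an iterate of the
Frobenius to the matrix and to the sequence. -/
lemma mem_ofList_of_map_mulVec_mem {n b c : ℕ} {A : Matrix (Fin c) (Fin b) R} {xs : List R}
    (hx : IsWeaklyRegular R xs)
    (hA : ∀ v, (∀ i, A.mulVec v i ∈ Ideal.ofList xs) → ∀ j, v j ∈ Ideal.ofList xs)
    {v : Fin b → R} (hv : ∀ i, (A.map (iterateFrobenius R p n)).mulVec v i ∈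
      Ideal.ofList (xs.map (· ^ p ^ n))) (j : Fin b) :
    v j ∈ Ideal.ofList (xs.map (· ^ p ^ n)) := by
  obtain ⟨y, hy, hreg⟩ := Matrix.exists_mem_span_det_submatrix_isSMulRegular hA
  have hxy : IsWeaklyRegular R (xs ++ [y]) := by
    rw [isWeaklyRegular_append_iff, isWeaklyRegular_singleton_iff]
    exact ⟨hx, ((Submodule.quotEquivOfEq (Ideal.ofList xs • ⊤ : Submodule R R) (Ideal.ofList xs)
      (by simp)).isSMulRegular_congr y).2 hreg⟩
  have hpow := hxy.map_pow (p ^ n)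
  rw [List.map_append, List.map_singleton, isWeaklyRegular_append_iff,
    isWeaklyRegular_singleton_iff] at hpow
  have hyreg : IsSMulRegular (R ⧸ Ideal.ofList (xs.map (· ^ p ^ n))) (y ^ p ^ n) :=
    ((Submodule.quotEquivOfEq (Ideal.ofList (xs.map (· ^ p ^ n)) • ⊤ : Submodule R R) _
      (by simp)).isSMulRegular_congr _).1 hpow.2
  refine mem_of_isSMulRegular_quotient_of_smul_mem hyreg ?_
  rw [smul_eq_mul, ← iterateFrobenius_def p n y]
  have hle : Ideal.span (Set.range fun f : Fin b → Fin c => (A.submatrix f id).det) ≤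
      ((Ideal.ofList (xs.map (· ^ p ^ n))).colon {v j}).comap (iterateFrobenius R p n) := by
    rw [Ideal.span_le]
    rintro _ ⟨f, rfl⟩
    have := Matrix.det_submatrix_mul_mem hv f j
    rw [SetLike.mem_coe, Ideal.mem_comap, Submodule.mem_colon_singleton, smul_eq_mul,
      RingHom.map_det]
    exact this
  exact Submodule.mem_colon_singleton.1 (hle hy)

/-- A module of the form `M / xs M`, where `M` has a finite free resolution of length one and `xs`
is regular on `R` and on `M`, has no higher `Tor` with the Frobenius. -/
lemma torSuccVanishes_of_finite_free_resolution {M : Type u} [AddCommGroup M] [Module R M]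
    {xs : List R} (hx : IsWeaklyRegular R xs) (hxM : IsWeaklyRegular M xs) {b c : ℕ}
    {f : (Fin b → R) →ₗ[R] (Fin c → R)} {g : (Fin c → R) →ₗ[R] M} (hf : Injective f)
    (hfg : Exact f g) (hg : Surjective g) (n j : ℕ) :
    TorSuccVanishes R (quotSeq M xs) j (FrobeniusTwist R p n) := by
  have hxS : IsWeaklyRegular (FrobeniusTwist R p n) xs := isWeaklyRegular_frobeniusTwist hx
  cases j with
  | succ j =>
    exact (torSuccVanishes_quotient_succ_iff hf hfg hg hx hxS hxM j).2
      (torSuccVanishes_quotient_of_flat hx hxS j)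
  | zero =>
    refine (torSuccVanishes_quotient_zero_iff hf hfg hg hx hxS hxM).2 fun e he => ?_
    rw [← (TensorProduct.piScalarRight R (FrobeniusTwist R p n) (FrobeniusTwist R p n)
      _).apply_mem_smul_top_iff, Pi.mem_ideal_smul_top_iff] at he ⊢
    rw [piScalarRight_baseChange] at he
    refine mem_ofList_of_map_mulVec_mem (R := R) (p := p) (n := n) hx (fun v hv => ?_) he
    rw [← Pi.mem_ideal_smul_top_iff]
    refine mem_ofList_smul_top_of_exact hf hfg hg hxM ?_
    rw [Pi.mem_ideal_smul_top_iff, ← LinearMap.toMatrix'_mulVec]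
    exact hv

variable [IsLocalRing R]

/-- If one `Tor` module of `M / xs M` with a high enough iterate of the Frobenius vanishes, then
`M` has finite projective dimension. -/
lemma exists_hasProjectiveDimensionLT_of_torSuccVanishes {xs : List R} {z : R}
    (hxs : ∀ x ∈ xs, x ∈ maximalIdeal R) (hz : z ∈ maximalIdeal R)
    (hreg : IsWeaklyRegular R (xs ++ [z])) {ys : List R} (hys : ∀ y ∈ ys, y ∈ maximalIdeal R)
    (hlen : ys.length = xs.length + 1)
    (hdim : Module.supportDim R (R ⧸ Ideal.ofList ys) ≤ 0) {n : ℕ}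
    (hmy : (maximalIdeal R).map (iterateFrobenius R p n) ≤ Ideal.ofList ys) (j : ℕ)
    (M : Type u) [AddCommGroup M] [Module R M] [Module.Finite R M] (hxM : IsWeaklyRegular M xs)
    (hTor : TorSuccVanishes R (quotSeq M xs) j (FrobeniusTwist R p n)) :
    ∃ k, HasProjectiveDimensionLT (ModuleCat.of R M) (k + 1) := by
  have hx : IsWeaklyRegular R xs := ((isWeaklyRegular_append_iff _ _ _).1 hreg).1
  have hxS : IsWeaklyRegular (FrobeniusTwist R p n) xs := isWeaklyRegular_frobeniusTwist hx
  induction j generalizing M with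
  | zero =>
    obtain ⟨c, g, hg⟩ := Module.Finite.exists_fin' R M
    have hinj := Submodule.injective_subtype (LinearMap.ker g)
    have hex := LinearMap.exact_subtype_ker_map g
    obtain ⟨b, f, hf, hker⟩ := IsLocalRing.exists_minimal_cover (R := R) (LinearMap.ker g)
    have hpow : ∀ r ∈ maximalIdeal R,
        algebraMap R (FrobeniusTwist R p n) r ∈ maximalIdeal (FrobeniusTwist R p n) := fun r hr =>
      Ideal.pow_mem_of_mem (maximalIdeal R) hr _ (pow_pos (Fact.out : p.Prime).pos n)
    have hregS : IsWeaklyRegular (FrobeniusTwist R p n)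
        (xs.map (algebraMap R (FrobeniusTwist R p n)) ++
          [algebraMap R (FrobeniusTwist R p n) z]) := by
      simpa using isWeaklyRegular_map_frobeniusTwist (p := p) (n := n) hreg
    have hbc := baseChange_comp_injective (S := FrobeniusTwist R p n) (LinearMap.ker g).subtype
      (fun x hx => by
        obtain ⟨x, hx', rfl⟩ := List.mem_map.1 hx
        exact hpow x (hxs x hx')) (hpow z hz) hregS
      ((torSuccVanishes_quotient_zero_iff hinj hex hg hx hxS hxM).1 hTor)
      (ys := ys) hys (by rw [List.length_map]; exact hlen) hdim hmy hf hker
    let A := LinearMap.toMatrix' ((LinearMap.ker g).subtype ∘ₗ f)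
    have hAφ : Injective (A.map (iterateFrobenius R p n)).mulVec := by
      intro v w hvw
      let eb := TensorProduct.piScalarRight R (FrobeniusTwist R p n) (FrobeniusTwist R p n) (Fin b)
      let ec := TensorProduct.piScalarRight R (FrobeniusTwist R p n) (FrobeniusTwist R p n) (Fin c)
      obtain ⟨v, rfl⟩ := eb.surjective v
      obtain ⟨w, rfl⟩ := eb.surjective w
      refine congrArg eb (hbc (ec.injective ?_))
      rw [piScalarRight_baseChange, piScalarRight_baseChange]
      exact hvw
    have hA : Injective A.mulVec :=
      Matrix.mulVec_injective_of_map_injective (iterateFrobenius R p n) (fun r => by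
        rw [iterateFrobenius_def]
        exact dvd_pow_self r (pow_pos (Fact.out : p.Prime).pos n).ne') hAφ
    have hfinj : Injective f := by
      intro v w hvw
      refine hA ?_
      simp [A, LinearMap.toMatrix'_mulVec, hvw]
    have hfree : Module.Free R (LinearMap.ker g) :=
      Module.Free.of_equiv (LinearEquiv.ofBijective f ⟨hfinj, hf⟩)
    refine ⟨1, ((LinearMap.shortExact_shortComplexKer hg).hasProjectiveDimensionLT_X₃_iff 0
      ((IsProjective.iff_projective (Fin c → R)).1 inferInstance)).2 ?_⟩
    exact projective_iff_hasProjectiveDimensionLT_one.1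
      ((IsProjective.iff_projective (LinearMap.ker g)).1 inferInstance)
  | succ j ih =>
    obtain ⟨c, g, hg⟩ := Module.Finite.exists_fin' R M
    have hinj := Submodule.injective_subtype (LinearMap.ker g)
    have hex := LinearMap.exact_subtype_ker_map g
    obtain ⟨k, hk⟩ := ih (LinearMap.ker g)
      (IsWeaklyRegular.of_exact_left hinj hex hg (IsWeaklyRegular.of_flat_module hx) hxM)
      ((torSuccVanishes_quotient_succ_iff hinj hex hg hx hxS hxM j).1 hTor)
    exact ⟨k + 1, ((LinearMap.shortExact_shortComplexKer hg).hasProjectiveDimensionLT_X₃_iff k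
      ((IsProjective.iff_projective (Fin c → R)).1 inferInstance)).2 hk⟩

/-- A module of finite projective dimension whose dimension is less by one than that of the
Cohen–Macaulay ring, in the sense that `xs` is regular on it, has a free resolution of length
one. -/
lemma exists_finite_free_resolution {xs : List R} {z : R}
    (hxs : ∀ x ∈ xs, x ∈ maximalIdeal R) (hz : z ∈ maximalIdeal R)
    (hreg : IsWeaklyRegular R (xs ++ [z]))
    (hdim : Module.supportDim R (R ⧸ Ideal.ofList (xs ++ [z])) ≤ 0)
    (M : Type u) [AddCommGroup M] [Module R M] [Module.Finite R M] (hxM : IsWeaklyRegular M xs)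
    {k : ℕ} (hpd : HasProjectiveDimensionLT (ModuleCat.of R M) (k + 1)) :
    ∃ (b c : ℕ) (f : (Fin b → R) →ₗ[R] (Fin c → R)) (g : (Fin c → R) →ₗ[R] M),
      Injective f ∧ Exact f g ∧ Surjective g := by
  obtain ⟨c, g, hg⟩ := Module.Finite.exists_fin' R M
  have hinj := Submodule.injective_subtype (LinearMap.ker g)
  have hex := LinearMap.exact_subtype_ker_map g
  have hregF : IsWeaklyRegular (Fin c → R) (xs ++ [z]) := IsWeaklyRegular.of_flat_module hreg
  rw [isWeaklyRegular_append_iff, isWeaklyRegular_singleton_iff] at hregF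
  have hregK : IsWeaklyRegular (LinearMap.ker g) (xs ++ [z]) := by
    rw [isWeaklyRegular_append_iff, isWeaklyRegular_singleton_iff]
    exact ⟨IsWeaklyRegular.of_exact_left hinj hex hg hregF.1 hxM,
      hregF.2.of_injective _ (mapQ_ofList_injective hinj hex hg hxM)⟩
  have hpd' : HasProjectiveDimensionLT (ModuleCat.of R (LinearMap.ker g)) (k + 1) :=
    ((LinearMap.shortExact_shortComplexKer hg).hasProjectiveDimensionLT_X₃_iff k
      ((IsProjective.iff_projective (Fin c → R)).1 inferInstance)).1
      (hasProjectiveDimensionLT_of_ge (ModuleCat.of R M) (k + 1) (k + 2) (by omega))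
  have hfree := free_of_hasProjectiveDimensionLT (by
    simp only [List.mem_append, List.mem_singleton]
    rintro w (hw | rfl)
    exacts [hxs w hw, hz]) hreg hdim k (LinearMap.ker g) hregK hpd'
  let e := (Module.finBasis R (LinearMap.ker g)).equivFun.symm
  refine ⟨_, c, (LinearMap.ker g).subtype ∘ₗ e.toLinearMap, g, hinj.comp e.injective, ?_, hg⟩
  intro v
  rw [hex v]
  exact (e.surjective.range_comp (LinearMap.ker g).subtype ▸ Iff.rfl)

end FrobeniusRigidity

theorem corollary2p10 {R : Type u} [CommRing R] [IsNoetherianRing R] [IsLocalRing R]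
    (p : ℕ) [Fact p.Prime] [CharP R p]
    (hR : FrobeniusRigidity.IsCohenMacaulayModule R R) (hd : 0 < ringKrullDim R)
    (M : Type u) [AddCommGroup M] [Module R M] [Module.Finite R M]
    (hM : FrobeniusRigidity.IsCohenMacaulayModule R M)
    (hcodim : Module.supportDim R M + 1 = ringKrullDim R)
    (xs : List R) (hxM : FrobeniusRigidity.IsSystemOfParameters M xs)
    (hxR : RingTheory.Sequence.IsRegular R xs) :
    List.TFAE
      [projectiveDimension (ModuleCat.of R M) < ⊤,
       ∀ i n : ℕ, 0 < i → 0 < n → Limits.IsZero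
         (FrobeniusRigidity.frobeniusTor R p i n (FrobeniusRigidity.quotSeq M xs)),
       ∃ i n : ℕ, 0 < i ∧ FrobeniusRigidity.kappa R p ≤ n ∧ Limits.IsZero
         (FrobeniusRigidity.frobeniusTor R p i n (FrobeniusRigidity.quotSeq M xs))] := by
  have hdim : ringKrullDim R = ((xs.length + 1 : ℕ) : ℕ∞) := by
    rw [← hcodim, ← hxM.length_eq]; rfl
  have hregM := hxM.isWeaklyRegular hM
  have hxs := hxM.mem_maximalIdeal
  obtain ⟨ws, hwlen, hw, hws⟩ := hR.exists_isRegular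
    (by rw [Module.supportDim_self_eq_ringKrullDim, hdim])
  obtain ⟨zs, hzlen, hz, hzs⟩ :=
    FrobeniusRigidity.exists_isRegular_quotient_ofList hxs hxR.1 hw hws hwlen
  obtain ⟨z, rfl⟩ := List.length_eq_one_iff.1 hzlen
  have hz : z ∈ maximalIdeal R := hz z (by simp)
  have hreg : RingTheory.Sequence.IsWeaklyRegular R (xs ++ [z]) :=
    (RingTheory.Sequence.isWeaklyRegular_append_iff _ _ _).2 ⟨hxR.1, hzs.1⟩
  tfae_have 1 → 2 := by
    intro h i n hi _
    obtain ⟨k, hk⟩ := (projectiveDimension_ne_top_iff _).1 h.ne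
    obtain ⟨i, rfl⟩ := Nat.exists_eq_succ_of_ne_zero hi.ne'
    have hdim' := FrobeniusRigidity.supportDim_quotient_le_zero_of_isRegular (zs := xs ++ [z]) (by
      simp only [List.mem_append, List.mem_singleton]
      rintro w (hw | rfl)
      exacts [hxs w hw, hz]) hreg (by simpa using hdim)
    obtain ⟨b, c, f, g, hf, hfg, hg⟩ :=
      FrobeniusRigidity.exists_finite_free_resolution hxs hz hreg hdim' M hregM hk
    exact (FrobeniusRigidity.isZero_frobeniusTor_succ_iff _ _).2
      (FrobeniusRigidity.torSuccVanishes_of_finite_free_resolution hxR.1 hregM hf hfg hg n i)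
  tfae_have 2 → 3 := fun h =>
    ⟨1, max 1 (FrobeniusRigidity.kappa R p), one_pos, le_max_right _ _,
      h _ _ one_pos (lt_max_of_lt_left one_pos)⟩
  tfae_have 3 → 1 := by
    rintro ⟨i, n, hi, hn, h⟩
    obtain ⟨i, rfl⟩ := Nat.exists_eq_succ_of_ne_zero hi.ne'
    obtain ⟨ys, hys, hmy⟩ :=
      FrobeniusRigidity.exists_systemOfParameters_of_kappa_le p hR hdim hn
    have hylen : ys.length = xs.length + 1 := by
      have := hys.length_eq
      rw [Module.supportDim_self_eq_ringKrullDim, hdim] at this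
      exact_mod_cast this
    have hydim : Module.supportDim R (R ⧸ Ideal.ofList ys) ≤ 0 := by
      rw [← Module.supportDim_eq_of_equiv (Submodule.quotEquivOfEq
        (Ideal.ofList ys • ⊤ : Submodule R R) (Ideal.ofList ys) (by simp))]
      exact hys.finite_length.supportDim_le_zero
    obtain ⟨k, hk⟩ := FrobeniusRigidity.exists_hasProjectiveDimensionLT_of_torSuccVanishes hxs hz
      hreg hys.mem_maximalIdeal hylen hydim hmy i M hregM
      ((FrobeniusRigidity.isZero_frobeniusTor_succ_iff _ _).1 h)
    exact ((projectiveDimension_ne_top_iff _).2 ⟨k, hk⟩).lt_top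
  tfae_finish
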